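/- Sets are subsets of $\omega$, and $\Phi_0,\Phi_1,\dots$ is a standard enumeration of the Turing functionals. A (Turing) ideal is a non-empty collection $\mathcal I$ of sets closed under $\le_T$ and $\oplus$. Let $\mathcal I$ be a countable ideal, presented by a fixed exact pair $A_0,A_1$, i.e. $S\in\mathcal I$ if and only if $S\le_T A_0$ and $S\le_T A_1$; write $\Sigma^0_n(\mathcal I)$ for $\Sigma^0_n(A_0\oplus A_1)$. An $\mathcal I$-condition is a pair $(D,S)$ with $D$ finite, $S\in\mathcal I$ infinite and $\max D<\min S$. An $\mathcal I$-condition $(\widetilde D,\widetilde S)$ extends $(D,S)$ if $D\subseteq\widetilde D\subseteq D\cup S$ and $\widetilde S\subseteq S$. A set $G$ satisfies $(D,S)$ if $D\subseteq G\subseteq D\cup S$. An index of $(D,S)$ is a code $\langle d,e_0,e_1\rangle$ where $d$ is the canonical index of $D$ and $\Phi_{e_0}^{A_0}=S=\Phi_{e_1}^{A_1}$; a collection of $\mathcal I$-conditions is $\Sigma^0_n(\mathcal I)$-definable if the set of all indices of its members is $\Sigma^0_n(\mathcal I)$. A set $G$ is $n$-$\mathcal I$-generic if for every $\Sigma^0_n(\mathcal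 I)$-definable collection $\mathcal C$ of $\mathcal I$-conditions, $G$ satisfies either some member of $\mathcal C$ or some $\mathcal I$-condition that has no extension in $\mathcal C$. For a set $A$, a set $T$ is $\mathcal I$-hereditarily uniformly $A$-computing if there is an $e\in\omega$ such that $\Phi_e^{U}=A$ for every infinite $U\subseteq T$ with $U\in\mathcal I$. Corollary. Let $n\ge 4$ and let $A$ be any $\Delta^0_n$ set. Then the following are equivalent: 1. every $n$-$\mathcal I$-generic set $G$ computes $A$; 2. every infinite set $S\in\mathcal I$ has an infinite subset $T\in\mathcal I$ that is $\mathcal I$-hereditarily uniformly $A$-computing. -/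

import Mathlib

/-!
Turing ideals presented by exact pairs, the arithmetical hierarchy relative to an oracle, and
Mathias forcing over a Turing ideal. "Set" means set of natural numbers.
-/

namespace MathiasForcing

open Encodable

/-! ### Turing reducibility and Turing functionals -/

open Classical in
/-- The characteristic function of a set of natural numbers. -/
noncomputable def chi (B : Set ℕ) (x : ℕ) : ℕ := if x ∈ B then 1 else 0

/-- `A ≤_T B` for sets of natural numbers: Turing reducibility of characteristic functions. -/
def SetTuringReducible (A B : Set ℕ) : Prop :=
  TuringReducible (fun x => Part.some (chi A x)) (fun x => Part.some (chi B x))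

open Classical in
/-- The initial segment `B ↾ s` of (the characteristic function of) `B`, as a binary string of
length `s`. -/
noncomputable def restrict (B : Set ℕ) (s : ℕ) : List Bool :=
  (List.range s).map fun i => decide (i ∈ B)

/-- The `e`-th Turing functional `Φ_e^B(x)`. At stage `m = ⟨t, s⟩` the `e`-th program is run for
`t` steps on input `(B ↾ s, x)`; the value is the output at the first stage at which the program
has halted, and `Φ_e^B(x)` diverges if there is no such stage. -/
noncomputable def Phi (e : ℕ) (B : Set ℕ) (x : ℕ) : Part ℕ :=
  Nat.rfindOpt fun m =>
    Nat.Partrec.Code.evaln m.unpair.1 (Denumerable.ofNat Nat.Partrec.Code e)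
      (encode (restrict B m.unpair.2, x))

/-- `Φ_e^B = A`: the functional is total on the oracle `B`, with values the characteristic
function of `A`. -/
def Computes (e : ℕ) (B A : Set ℕ) : Prop :=
  ∀ x, Phi e B x = Part.some (chi A x)

/-! ### The arithmetical hierarchy relative to an oracle -/

/-- `P` is `Σ⁰_n(B)`: for `n = 0` it is computable from `B`, and `Σ⁰_{n+1}(B)` sets are the
projections of complements of `Σ⁰_n(B)` sets, i.e. of `Π⁰_n(B)` sets. -/
def IsSigma (B : Set ℕ) : ℕ → Set ℕ → Prop
  | 0, P => SetTuringReducible P B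
  | n + 1, P => ∃ Q : Set ℕ, IsSigma B n Qᶜ ∧ P = {x | ∃ y, Nat.pair x y ∈ Q}

/-- `P` is `Δ⁰_n(B)`: both `P` and its complement are `Σ⁰_n(B)`. -/
def IsDelta (B : Set ℕ) (n : ℕ) (P : Set ℕ) : Prop :=
  IsSigma B n P ∧ IsSigma B n Pᶜ

/-! ### Turing ideals -/

/-- The join `A ⊕ B`. -/
def join (A B : Set ℕ) : Set ℕ :=
  {z | ∃ x ∈ A, z = 2 * x} ∪ {z | ∃ x ∈ B, z = 2 * x + 1}

/-- A Turing ideal: a non-empty collection of sets closed under `≤_T` and `⊕`. -/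
structure IsTuringIdeal (I : Set (Set ℕ)) : Prop where
  nonempty : I.Nonempty
  downward_closed : ∀ A ∈ I, ∀ B, SetTuringReducible B A → B ∈ I
  join_closed : ∀ A ∈ I, ∀ B ∈ I, join A B ∈ I

/-- `A₀, A₁` is an exact pair for `I`. -/
def IsExactPair (A₀ A₁ : Set ℕ) (I : Set (Set ℕ)) : Prop :=
  ∀ S, S ∈ I ↔ SetTuringReducible S A₀ ∧ SetTuringReducible S A₁

/-- `S` is `I`-hereditarily uniformly `A`-computing: a single functional computes `A` from every
infinite subset of `S` in `I`. -/
def HereditarilyUniformlyComputing (I : Set (Set ℕ)) (A S : Set ℕ) : Prop :=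
  ∃ e, ∀ T ∈ I, T ⊆ S → T.Infinite → Computes e T A

/-! ### Mathias forcing over a Turing ideal -/

/-- A Mathias condition `(D, S)`: `D` finite, `S` infinite, `max D < min S`. -/
structure MathiasCondition where
  D : Finset ℕ
  S : Set ℕ
  infinite : S.Infinite
  lt : ∀ d ∈ D, ∀ s ∈ S, d < s

/-- `q` extends `p`. -/
def MathiasCondition.Extends (q p : MathiasCondition) : Prop :=
  p.D ⊆ q.D ∧ (∀ x ∈ q.D, x ∈ p.D ∨ x ∈ p.S) ∧ q.S ⊆ p.S

/-- The set `G` satisfies the condition `p`. -/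
def Satisfies (G : Set ℕ) (p : MathiasCondition) : Prop :=
  (∀ x ∈ p.D, x ∈ G) ∧ ∀ x ∈ G, x ∈ p.D ∨ x ∈ p.S

/-- `G` meets the collection `C` of conditions. -/
def Meets (G : Set ℕ) (C : Set MathiasCondition) : Prop :=
  ∃ p ∈ C, Satisfies G p

/-- `G` avoids the collection `C`: it satisfies an `I`-condition having no extension in `C`. -/
def Avoids (I : Set (Set ℕ)) (G : Set ℕ) (C : Set MathiasCondition) : Prop :=
  ∃ p : MathiasCondition, p.S ∈ I ∧ Satisfies G p ∧ ∀ q ∈ C, ¬ q.Extends p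

/-- `c` is an index, relative to the exact pair `A₀, A₁`, of the condition `(D, S)`:
`c = ⟨d, ⟨e₀, e₁⟩⟩` with `d` the canonical index of `D` and `Φ_{e₀}^{A₀} = S = Φ_{e₁}^{A₁}`. -/
def IsIndex (A₀ A₁ : Set ℕ) (p : MathiasCondition) (c : ℕ) : Prop :=
  ∃ e₀ e₁, c = Nat.pair (∑ i ∈ p.D, 2 ^ i) (Nat.pair e₀ e₁) ∧
    Computes e₀ A₀ p.S ∧ Computes e₁ A₁ p.S

/-- `C` is a `Σ⁰_n(I)`-definable collection of `I`-conditions, for the ideal `I` presented by the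
exact pair `A₀, A₁`: the set of all indices of members of `C` is `Σ⁰_n(A₀ ⊕ A₁)`. -/
def IsSigmaCollection (I : Set (Set ℕ)) (A₀ A₁ : Set ℕ) (n : ℕ)
    (C : Set MathiasCondition) : Prop :=
  (∀ p ∈ C, p.S ∈ I) ∧ IsSigma (join A₀ A₁) n {c | ∃ p ∈ C, IsIndex A₀ A₁ p c}

/-- `G` is `n`-`I`-generic, for the ideal `I` presented by the exact pair `A₀, A₁`. -/
def IsGeneric (I : Set (Set ℕ)) (A₀ A₁ : Set ℕ) (n : ℕ) (G : Set ℕ) : Prop :=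
  ∀ C, IsSigmaCollection I A₀ A₁ n C → Meets G C ∨ Avoids I G C

end MathiasForcing

/-! The two directions rest on different facts about Mathias forcing over `I`.

From 2 to 1: taking S = ω in 2 gives a T in `I` that computes `A`, so `A` is computable from A₀ ⊕
A₁. The collection of conditions whose reservoir is hereditarily uniformly `A`-computing is then
Σ⁰₄(I): some e is such that every i fails to index an infinite subset of the reservoir (Σ⁰₂), or Φ_e
of the set with index i is `A` (Π⁰₂). This is `isSigmaCollection_hereditarilyUniformlyComputing`. By
2 the collection is dense, so a generic G satisfies a member (D, T), with functional e. Since G \ D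
need not belong to `I`, genericity is used once more, for each x, to find a finite part that already
makes Φ_e(x) converge. The value is correct because that finite part, without D, can be completed to
an infinite subset of T in `I` (`IsGeneric.exists_phiStr`).

From 1 to 2, by contraposition: suppose that S in `I` has no infinite subset in `I` of the required
kind. A generic G is built below (∅, S), deciding countably many collections and defeating every
functional. If no extension of a condition (D, V) forces Φ_e^G ≠ A, then every infinite subset U of
V in `I` computes `A` uniformly, by searching for any finite set between D and D ∪ U on which Φ_e
converges (`hereditarilyUniformlyComputing_of_not_forced`). This contradicts the choice of S, so
each functional can be defeated.

The link between relative recursiveness and the functionals `Phi` is a calculus of primitive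
recursive operations on initial segments of the oracle: `exists_approximates`, `exists_functional`
and `reducible_of_approx`. -/

namespace MathiasForcing

open Encodable Denumerable
open Nat.Partrec (Code)

/-! ### Strings and bounded searches -/

/-- The first value of `f` on arguments below `n`. -/
def firstSome (f : ℕ → Option ℕ) (n : ℕ) : Option ℕ :=
  Nat.rec none (fun k r => r <|> f k) n

theorem firstSome_succ (f : ℕ → Option ℕ) (n : ℕ) :
    firstSome f (n + 1) = (firstSome f n <|> f n) := rfl

theorem firstSome_congr {f g : ℕ → Option ℕ} {n : ℕ} (h : ∀ m < n, f m = g m) :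
    firstSome f n = firstSome g n := by
  induction n with
  | zero => rfl
  | succ n ih =>
    rw [firstSome_succ, firstSome_succ, ih fun m hm => h m (hm.trans n.lt_succ_self),
      h n n.lt_succ_self]

theorem firstSome_mono {f : ℕ → Option ℕ} {n m v : ℕ} (hnm : n ≤ m)
    (h : firstSome f n = some v) : firstSome f m = some v := by
  induction hnm with
  | refl => exact h
  | step _ ih => rw [firstSome_succ, ih]; rfl

theorem exists_of_firstSome {f : ℕ → Option ℕ} {n v : ℕ} (h : firstSome f n = some v) :
    ∃ m < n, f m = some v := by
  induction n with
  | zero => cases h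
  | succ n ih =>
    rw [firstSome_succ] at h
    cases hn : firstSome f n with
    | none => rw [hn] at h; exact ⟨n, n.lt_succ_self, h⟩
    | some w =>
      rw [hn] at h
      obtain ⟨m, hm, e⟩ := ih (hn.trans h)
      exact ⟨m, hm.trans n.lt_succ_self, e⟩

theorem firstSome_isSome {f : ℕ → Option ℕ} {m n : ℕ} (hm : m < n) (h : (f m).isSome) :
    ∃ v, firstSome f n = some v := by
  have : ∃ v, firstSome f (m + 1) = some v := by
    rw [firstSome_succ]
    cases firstSome f m with
    | none => exact Option.isSome_iff_exists.1 h
    | some w => exact ⟨w, rfl⟩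
  exact this.imp fun v hv => firstSome_mono hm hv

theorem mem_rfindOpt_iff_firstSome {f : ℕ → Option ℕ} {v : ℕ} :
    v ∈ Nat.rfindOpt f ↔ ∃ n, firstSome f n = some v := by
  have key : ∀ {w}, w ∈ Nat.rfindOpt f → ∃ n, firstSome f n = some w := by
    intro w hw
    obtain ⟨n, hn, hw⟩ := Part.mem_bind_iff.1 hw
    have hlt : ∀ {m}, m < n → f m = none := fun {m} hm => by
      have := Nat.rfind_min hn hm
      simpa using this
    have : firstSome f n = none := by
      by_contra hne
      obtain ⟨u, hu⟩ := Option.ne_none_iff_exists'.1 hne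
      obtain ⟨m, hm, e⟩ := exists_of_firstSome hu
      rw [hlt hm] at e
      cases e
    refine ⟨n + 1, ?_⟩
    rw [firstSome_succ, this]
    simpa using hw
  refine ⟨key, fun ⟨n, hn⟩ => ?_⟩
  obtain ⟨m, -, hm⟩ := exists_of_firstSome hn
  obtain ⟨w, hw⟩ := Part.dom_iff_mem.1 (Nat.rfindOpt_dom.2 ⟨m, v, hm⟩)
  obtain ⟨k, hk⟩ := key hw
  have := (firstSome_mono (le_max_left n k) hn).symm.trans (firstSome_mono (le_max_right n k) hk)
  rwa [Option.some.inj this]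

theorem primrec_firstSome {α : Type*} [Primcodable α] {f : α → ℕ → Option ℕ} {n : α → ℕ}
    (hf : Primrec₂ f) (hn : Primrec n) : Primrec fun a => firstSome (f a) (n a) :=
  Primrec.nat_rec' hn (Primrec.const none)
    (Primrec.option_orElse.comp (Primrec.snd.comp Primrec.snd)
      (hf.comp Primrec.fst (Primrec.fst.comp Primrec.snd))).to₂

theorem length_restrict (B : Set ℕ) (s : ℕ) : (restrict B s).length = s := by
  simp [restrict]

theorem take_restrict (B : Set ℕ) {s t : ℕ} (h : t ≤ s) :
    (restrict B s).take t = restrict B t := by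
  simp [restrict, ← List.map_take, List.take_range, h]

open Classical in
theorem getElem?_restrict (B : Set ℕ) {s i : ℕ} (h : i < s) :
    (restrict B s)[i]? = some (decide (i ∈ B)) := by
  simp [restrict, h]

open Classical in
theorem restrict_succ (B : Set ℕ) (s : ℕ) :
    restrict B (s + 1) = restrict B s ++ [decide (s ∈ B)] := by
  simp [restrict, List.range_succ]

theorem restrict_congr {B C : Set ℕ} {s : ℕ} (h : ∀ i < s, i ∈ B ↔ i ∈ C) :
    restrict B s = restrict C s := by
  classical
  refine List.map_congr_left fun i hi => ?_
  simp [h i (List.mem_range.1 hi)]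

theorem mem_of_getElem?_restrict {B : Set ℕ} {s i : ℕ} (h : (restrict B s)[i]? = some true) :
    i ∈ B := by
  obtain ⟨hi, -⟩ := List.getElem?_eq_some_iff.1 h
  rw [length_restrict] at hi
  rw [getElem?_restrict B hi] at h
  simpa using h

theorem eq_restrict {B : Set ℕ} {σ : List Bool}
    (h : ∀ i < σ.length, σ[i]? = some true ↔ i ∈ B) : σ = restrict B σ.length := by
  classical
  refine List.ext_getElem? fun i => ?_
  by_cases hi : i < σ.length
  · rw [getElem?_restrict B hi]
    have := h i hi
    rw [List.getElem?_eq_getElem hi] at this ⊢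
    simp only [Option.some.injEq] at this ⊢
    rw [Bool.eq_iff_iff, decide_eq_true_iff]
    exact this
  · rw [List.getElem?_eq_none (not_lt.1 hi), List.getElem?_eq_none]
    rw [length_restrict]
    exact not_lt.1 hi

/-! ### Turing functionals on strings -/

/-- The value of the `e`-th functional at `x` found within the bounds set by the string `σ`. -/
def phiStr (e : ℕ) (σ : List Bool) (x : ℕ) : Option ℕ :=
  firstSome (fun m => Code.evaln m.unpair.1 (ofNat Code e) (encode (σ.take m.unpair.2, x)))
    σ.length

/-- A stage m = ⟨t, r⟩ has r ≤ m, so stages below s consult only the first s bits of the oracle. -/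
theorem phiStr_restrict (e : ℕ) (B : Set ℕ) (s x : ℕ) :
    phiStr e (restrict B s) x = firstSome (fun m =>
      Code.evaln m.unpair.1 (ofNat Code e) (encode (restrict B m.unpair.2, x))) s := by
  rw [phiStr, length_restrict]
  refine firstSome_congr fun m hm => ?_
  rw [take_restrict B ((Nat.unpair_right_le m).trans hm.le)]

theorem mem_Phi_iff {e : ℕ} {B : Set ℕ} {x v : ℕ} :
    v ∈ Phi e B x ↔ ∃ s, phiStr e (restrict B s) x = some v := by
  simp only [phiStr_restrict]
  exact mem_rfindOpt_iff_firstSome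

theorem phiStr_mono {e : ℕ} {B : Set ℕ} {x v s t : ℕ} (hst : s ≤ t)
    (h : phiStr e (restrict B s) x = some v) : phiStr e (restrict B t) x = some v := by
  rw [phiStr_restrict] at h ⊢
  exact firstSome_mono hst h

theorem computes_iff {e : ℕ} {B A : Set ℕ} :
    Computes e B A ↔ ∀ x, ∃ s, phiStr e (restrict B s) x = some (chi A x) := by
  simp only [Computes, Part.eq_some_iff, mem_Phi_iff]

theorem Computes.eq_chi {e : ℕ} {B A : Set ℕ} (h : Computes e B A) {s x v : ℕ}
    (hv : phiStr e (restrict B s) x = some v) : v = chi A x := by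
  have : v ∈ Phi e B x := mem_Phi_iff.2 ⟨s, hv⟩
  rw [h x] at this
  exact Part.mem_some_iff.1 this

theorem chi_eq_one {B : Set ℕ} {x : ℕ} : chi B x = 1 ↔ x ∈ B := by
  by_cases h : x ∈ B <;> simp [chi, h]

theorem chi_eq_zero {B : Set ℕ} {x : ℕ} : chi B x = 0 ↔ x ∉ B := by
  by_cases h : x ∈ B <;> simp [chi, h]

theorem Computes.unique {e : ℕ} {B A A' : Set ℕ} (h : Computes e B A) (h' : Computes e B A') :
    A = A' := by
  ext x
  have := Part.some_injective ((h x).symm.trans (h' x))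
  rw [← chi_eq_one, this, chi_eq_one]

theorem primrec_phiStr {α : Type*} [Primcodable α] {e : α → ℕ} {σ : α → List Bool} {x : α → ℕ}
    (he : Primrec e) (hσ : Primrec σ) (hx : Primrec x) :
    Primrec fun a => phiStr (e a) (σ a) (x a) := by
  refine primrec_firstSome ?_ (Primrec.list_length.comp hσ)
  have hm : Primrec fun p : α × ℕ => p.2.unpair := Primrec.unpair.comp Primrec.snd
  exact Code.primrec_evaln.comp (((Primrec.fst.comp hm).pair
    ((Primrec.ofNat Code).comp (he.comp Primrec.fst))).pair
    (Primrec.encode.comp ((Primrec.list_take.comp (Primrec.snd.comp hm)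
      (hσ.comp Primrec.fst)).pair (hx.comp Primrec.fst))))

/-- Every primitive recursive operation on strings yields a Turing functional. -/
theorem exists_functional {g : List Bool → ℕ → Option ℕ} (hg : Primrec₂ g) :
    ∃ e, ∀ (B : Set ℕ) (x w : ℕ), (∀ s v, g (restrict B s) x = some v → v = w) →
      (∃ s, (g (restrict B s) x).isSome) → Phi e B x = Part.some w := by
  have hp : Partrec fun p : List Bool × ℕ => (g p.1 p.2 : Part ℕ) :=
    Computable.ofOption hg.to_comp
  obtain ⟨c, hc⟩ := Code.exists_code.1 hp
  refine ⟨encode c, fun B x w h1 h2 => ?_⟩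
  have heval : ∀ s, c.eval (encode (restrict B s, x)) = (g (restrict B s) x : Part ℕ) := by
    intro s
    rw [hc]
    simp only [encodek, Part.coe_some, Part.bind_some]
    exact Part.map_id' (fun _ => rfl) _
  obtain ⟨s, hs⟩ := h2
  obtain ⟨v, hv⟩ := Option.isSome_iff_exists.1 hs
  have hv' : v ∈ c.eval (encode (restrict B s, x)) := by rw [heval, hv]; exact Part.mem_some v
  obtain ⟨k, hk⟩ := Code.evaln_complete.1 hv'
  have hdom : (Phi (encode c) B x).Dom := by
    rw [Phi, Nat.rfindOpt_dom]
    exact ⟨Nat.pair k s, v, by simpa using hk⟩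
  -- The stage found by the search may use a different segment of `B`; `h1` covers all segments.
  obtain ⟨u, hu⟩ := Part.dom_iff_mem.1 hdom
  obtain ⟨m, hm⟩ := Nat.rfindOpt_spec hu
  rw [ofNat_encode] at hm
  have hm' := Code.evaln_sound hm
  rw [heval] at hm'
  have : u = w := h1 _ _ (by simpa using hm')
  rw [Part.eq_some_iff]
  exact this ▸ hu

/-! ### Oracle computations and operations on strings -/

/-- The operation `g` on initial segments of `B` approximates the partial function `f`. -/
def Approximates (B : Set ℕ) (g : List Bool → ℕ → Option ℕ) (f : ℕ →. ℕ) : Prop :=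
  (∀ x v s t, s ≤ t → g (restrict B s) x = some v → g (restrict B t) x = some v) ∧
    ∀ x v, v ∈ f x ↔ ∃ s, g (restrict B s) x = some v

theorem approximates_of_total (B : Set ℕ) (f : ℕ → ℕ) :
    Approximates B (fun _ x => some (f x)) (fun x => Part.some (f x)) :=
  ⟨fun _ _ _ _ _ h => h, fun x v => by simp [eq_comm]⟩

theorem exists_uniform_bound {P : ℕ → ℕ → Prop} (mono : ∀ m s t, s ≤ t → P m s → P m t) {n : ℕ}
    (h : ∀ m < n, ∃ s, P m s) : ∃ s, ∀ m < n, P m s := by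
  induction n with
  | zero => exact ⟨0, fun m hm => absurd hm m.not_lt_zero⟩
  | succ n ih =>
    obtain ⟨s, hs⟩ := ih fun m hm => h m (hm.trans n.lt_succ_self)
    obtain ⟨t, ht⟩ := h n n.lt_succ_self
    refine ⟨max s t, fun m hm => ?_⟩
    rcases Nat.lt_succ_iff_lt_or_eq.1 hm with hm | rfl
    · exact mono _ _ _ (le_max_left _ _) (hs m hm)
    · exact mono _ _ _ (le_max_right _ _) ht

theorem approximates_pair {B : Set ℕ} {f₁ f₂ : ℕ →. ℕ} {g₁ g₂ : List Bool → ℕ → Option ℕ}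
    (h₁ : Approximates B g₁ f₁) (h₂ : Approximates B g₂ f₂) :
    Approximates B (fun σ x => (g₁ σ x).bind fun a => (g₂ σ x).map fun b => Nat.pair a b)
      (fun n => Nat.pair <$> f₁ n <*> f₂ n) := by
  constructor
  · intro x v s t hst h
    simp only [Option.bind_eq_some_iff, Option.map_eq_some_iff] at h ⊢
    obtain ⟨a, ha, b, hb, e⟩ := h
    exact ⟨a, h₁.1 _ _ _ _ hst ha, b, h₂.1 _ _ _ _ hst hb, e⟩
  · intro x v
    simp only [Seq.seq, Part.map_eq_map, Part.mem_bind_iff, Part.mem_map_iff,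
      Option.bind_eq_some_iff, Option.map_eq_some_iff]
    constructor
    · rintro ⟨_, ⟨a, ha, rfl⟩, b, hb, rfl⟩
      obtain ⟨s, hs⟩ := (h₁.2 _ _).1 ha
      obtain ⟨t, ht⟩ := (h₂.2 _ _).1 hb
      exact ⟨max s t, a, h₁.1 _ _ _ _ (le_max_left _ _) hs, b,
        h₂.1 _ _ _ _ (le_max_right _ _) ht, rfl⟩
    · rintro ⟨s, a, ha, b, hb, rfl⟩
      exact ⟨_, ⟨a, (h₁.2 _ _).2 ⟨s, ha⟩, rfl⟩, b, (h₂.2 _ _).2 ⟨s, hb⟩, rfl⟩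

theorem approximates_comp {B : Set ℕ} {f₁ f₂ : ℕ →. ℕ} {g₁ g₂ : List Bool → ℕ → Option ℕ}
    (h₁ : Approximates B g₁ f₁) (h₂ : Approximates B g₂ f₂) :
    Approximates B (fun σ x => (g₂ σ x).bind fun a => g₁ σ a) (fun n => f₂ n >>= f₁) := by
  constructor
  · intro x v s t hst h
    simp only [Option.bind_eq_some_iff] at h ⊢
    obtain ⟨a, ha, hb⟩ := h
    exact ⟨a, h₂.1 _ _ _ _ hst ha, h₁.1 _ _ _ _ hst hb⟩
  · intro x v
    simp only [Option.bind_eq_some_iff]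
    refine (Part.mem_bind_iff (f := f₂ x) (g := f₁)).trans ⟨?_, ?_⟩
    · rintro ⟨a, ha, hb⟩
      obtain ⟨s, hs⟩ := (h₂.2 _ _).1 ha
      obtain ⟨t, ht⟩ := (h₁.2 _ _).1 hb
      exact ⟨max s t, a, h₂.1 _ _ _ _ (le_max_left _ _) hs, h₁.1 _ _ _ _ (le_max_right _ _) ht⟩
    · rintro ⟨s, a, ha, hb⟩
      exact ⟨a, (h₂.2 _ _).2 ⟨s, ha⟩, (h₁.2 _ _).2 ⟨s, hb⟩⟩

/-- Primitive recursion on strings. -/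
def strPrec (g₁ g₂ : List Bool → ℕ → Option ℕ) (σ : List Bool) (a n : ℕ) : Option ℕ :=
  Nat.rec (g₁ σ a) (fun y r => r.bind fun i => g₂ σ (Nat.pair a (Nat.pair y i))) n

theorem approximates_prec {B : Set ℕ} {f₁ f₂ : ℕ →. ℕ} {g₁ g₂ : List Bool → ℕ → Option ℕ}
    (h₁ : Approximates B g₁ f₁) (h₂ : Approximates B g₂ f₂) :
    Approximates B (fun σ x => strPrec g₁ g₂ σ x.unpair.1 x.unpair.2)
      (fun p => let (a, n) := Nat.unpair p
        n.rec (f₁ a) fun y IH => do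
          let i ← IH
          f₂ (Nat.pair a (Nat.pair y i))) := by
  have mono : ∀ a n v s t, s ≤ t → strPrec g₁ g₂ (restrict B s) a n = some v →
      strPrec g₁ g₂ (restrict B t) a n = some v := by
    intro a n
    induction n with
    | zero => exact fun v s t => h₁.1 a v s t
    | succ n ih =>
      intro v s t hst h
      obtain ⟨i, hi, hv⟩ := Option.bind_eq_some_iff.1 h
      exact Option.bind_eq_some_iff.2 ⟨i, ih _ _ _ hst hi, h₂.1 _ _ _ _ hst hv⟩
  refine ⟨fun x v s t => mono _ _ v s t, fun x => ?_⟩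
  change ∀ v, v ∈ (Nat.rec (f₁ x.unpair.1) (fun y IH => IH.bind fun i =>
    f₂ (Nat.pair x.unpair.1 (Nat.pair y i))) x.unpair.2 : Part ℕ) ↔
      ∃ s, strPrec g₁ g₂ (restrict B s) x.unpair.1 x.unpair.2 = some v
  generalize x.unpair.1 = a
  generalize x.unpair.2 = n
  induction n with
  | zero => exact h₁.2 a
  | succ n ih =>
    intro v
    refine Part.mem_bind_iff.trans ⟨?_, ?_⟩
    · rintro ⟨i, hi, hv⟩
      obtain ⟨s, hs⟩ := (ih i).1 hi
      obtain ⟨t, ht⟩ := (h₂.2 _ _).1 hv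
      exact ⟨max s t, Option.bind_eq_some_iff.2 ⟨i, mono _ _ _ _ _ (le_max_left _ _) hs,
        h₂.1 _ _ _ _ (le_max_right _ _) ht⟩⟩
    · rintro ⟨s, hs⟩
      obtain ⟨i, hi, hv⟩ := Option.bind_eq_some_iff.1 hs
      exact ⟨i, (ih i).2 ⟨s, hi⟩, (h₂.2 _ _).2 ⟨s, hv⟩⟩

/-- Minimization on strings. -/
def strRfind (g : List Bool → ℕ → Option ℕ) (σ : List Bool) (a : ℕ) : Option ℕ :=
  firstSome (fun n => if g σ (Nat.pair a n) = some 0 ∧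
    ∀ m < n, ¬ (g σ (Nat.pair a m)).getD 0 = 0 then some n else none) σ.length

theorem strRfind_eq_some {g : List Bool → ℕ → Option ℕ} {σ : List Bool} {a n : ℕ} :
    strRfind g σ a = some n ↔ n < σ.length ∧ g σ (Nat.pair a n) = some 0 ∧
      ∀ m < n, ¬ (g σ (Nat.pair a m)).getD 0 = 0 := by
  constructor
  · intro h
    obtain ⟨m, hm, e⟩ := exists_of_firstSome h
    split_ifs at e with hc
    obtain rfl := Option.some.inj e
    exact ⟨hm, hc⟩
  · rintro ⟨hn, hc⟩
    obtain ⟨v, hv⟩ := firstSome_isSome (f := fun n => if g σ (Nat.pair a n) = some 0 ∧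
      ∀ m < n, ¬ (g σ (Nat.pair a m)).getD 0 = 0 then some n else none) hn (by
        simp only [if_pos hc, Option.isSome_some])
    obtain ⟨m, hm, e⟩ := exists_of_firstSome hv
    split_ifs at e with hc'
    obtain rfl := Option.some.inj e
    have : m = n := by
      rcases lt_trichotomy m n with h | h | h
      · exact absurd (by simp [hc'.1]) (hc.2 m h)
      · exact h
      · exact absurd (by simp [hc.1]) (hc'.2 n h)
    exact this ▸ hv

theorem approximates_rfind {B : Set ℕ} {f : ℕ →. ℕ} {g : List Bool → ℕ → Option ℕ}
    (h : Approximates B g f) :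
    Approximates B (strRfind g)
      (fun a => Nat.rfind fun n => (fun m => m = 0) <$> f (Nat.pair a n)) := by
  -- The default 0 makes an undefined earlier value fail the test, so minimization waits for
  -- convergence.
  have nz : ∀ (o : Option ℕ), ¬ o.getD 0 = 0 ↔ ∃ v, o = some v ∧ v ≠ 0 := by
    rintro (_ | v) <;> simp
  constructor
  · intro x v s t hst
    simp only [strRfind_eq_some, length_restrict, nz]
    rintro ⟨h1, h2, h3⟩
    refine ⟨h1.trans_le hst, h.1 _ _ _ _ hst h2, fun m hm => ?_⟩
    obtain ⟨u, hu, hu0⟩ := h3 m hm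
    exact ⟨u, h.1 _ _ _ _ hst hu, hu0⟩
  · intro x v
    refine Nat.mem_rfind.trans ?_
    simp only [strRfind_eq_some, length_restrict, nz, Part.map_eq_map, Part.mem_map_iff]
    constructor
    · rintro ⟨⟨u, hu, hu0⟩, hlt⟩
      obtain rfl : u = 0 := by simpa using hu0
      obtain ⟨s, hs⟩ := (h.2 _ _).1 hu
      obtain ⟨t, ht⟩ := exists_uniform_bound
        (P := fun m t => ∃ u, g (restrict B t) (Nat.pair x m) = some u ∧ u ≠ 0)
        (fun m a b hab ⟨u, hu, hu0⟩ => ⟨u, h.1 _ _ _ _ hab hu, hu0⟩) (n := v) (fun m hm => by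
          obtain ⟨u, hu, hu0⟩ := hlt hm
          obtain ⟨t, ht⟩ := (h.2 _ _).1 hu
          exact ⟨t, u, ht, by simpa using hu0⟩)
      refine ⟨max (v + 1) (max s t), by omega, h.1 _ _ s _ (by omega) hs, fun m hm => ?_⟩
      obtain ⟨u, hu, hu0⟩ := ht m hm
      exact ⟨u, h.1 _ _ t _ (by omega) hu, hu0⟩
    · rintro ⟨s, -, h2, h3⟩
      refine ⟨⟨0, (h.2 _ _).2 ⟨s, h2⟩, by simp⟩, fun {m} hm => ?_⟩
      obtain ⟨u, hu, hu0⟩ := h3 m hm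
      exact ⟨u, (h.2 _ _).2 ⟨s, hu⟩, by simpa using hu0⟩

/-- Induction on the derivation of `f`: each clause has a primitive recursive counterpart on
strings, and an oracle query at x is answered once the string is longer than x. -/
theorem exists_approximates {B : Set ℕ} {f : ℕ →. ℕ}
    (hf : Nat.RecursiveIn {fun x => Part.some (chi B x)} f) :
    ∃ g, Primrec₂ g ∧ Approximates B g f := by
  classical
  induction hf with
  | zero => exact ⟨_, Primrec₂.const _, approximates_of_total B fun _ => 0⟩
  | succ => exact ⟨_, (Primrec.option_some.comp (Primrec.succ.comp Primrec.snd)).to₂,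
      approximates_of_total B Nat.succ⟩
  | left => exact ⟨_, (Primrec.option_some.comp (Primrec.fst.comp
      (Primrec.unpair.comp Primrec.snd))).to₂, approximates_of_total B fun n => n.unpair.1⟩
  | right => exact ⟨_, (Primrec.option_some.comp (Primrec.snd.comp
      (Primrec.unpair.comp Primrec.snd))).to₂, approximates_of_total B fun n => n.unpair.2⟩
  | oracle f hf =>
    obtain rfl := Set.mem_singleton_iff.1 hf
    have key : ∀ x v s, (restrict B s)[x]?.map Bool.toNat = some v ↔ x < s ∧ chi B x = v := by
      intro x v s
      by_cases hx : x < s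
      · by_cases hB : x ∈ B <;> simp [getElem?_restrict B hx, hx, chi, hB]
      · have : (restrict B s)[x]? = none := by
          rw [List.getElem?_eq_none]; rw [length_restrict]; exact not_lt.1 hx
        simp [this, hx]
    refine ⟨fun σ x => σ[x]?.map Bool.toNat, Primrec.option_map Primrec.list_getElem?
      ((Primrec.dom_bool _).comp Primrec.snd).to₂, ?_, ?_⟩
    · intro x v s t hst
      simp only [key]
      exact fun h => ⟨h.1.trans_le hst, h.2⟩
    · intro x v
      simp only [key, Part.mem_some_iff]
      exact ⟨fun h => ⟨x + 1, x.lt_succ_self, h.symm⟩, fun ⟨_, h⟩ => h.2.symm⟩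
  | pair _ _ ih₁ ih₂ =>
    obtain ⟨g₁, p₁, h₁⟩ := ih₁
    obtain ⟨g₂, p₂, h₂⟩ := ih₂
    refine ⟨_, ?_, approximates_pair h₁ h₂⟩
    exact Primrec.option_bind p₁ (Primrec.option_map
      (p₂.comp (Primrec.fst.comp Primrec.fst) (Primrec.snd.comp Primrec.fst))
      (Primrec₂.natPair.comp (Primrec.snd.comp Primrec.fst) Primrec.snd).to₂).to₂
  | comp _ _ ih₁ ih₂ =>
    obtain ⟨g₁, p₁, h₁⟩ := ih₁
    obtain ⟨g₂, p₂, h₂⟩ := ih₂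
    refine ⟨_, ?_, approximates_comp h₁ h₂⟩
    exact Primrec.option_bind p₂ (p₁.comp (Primrec.fst.comp Primrec.fst) Primrec.snd).to₂
  | prec _ _ ih₁ ih₂ =>
    obtain ⟨g₁, p₁, h₁⟩ := ih₁
    obtain ⟨g₂, p₂, h₂⟩ := ih₂
    refine ⟨_, ?_, approximates_prec h₁ h₂⟩
    have hu : Primrec fun p : List Bool × ℕ => p.2.unpair := Primrec.unpair.comp Primrec.snd
    have h1 : Primrec fun p : ((List Bool × ℕ) × (ℕ × Option ℕ)) × ℕ => p.1.1 :=
      Primrec.fst.comp Primrec.fst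
    have h2 : Primrec₂ fun (p : (List Bool × ℕ) × (ℕ × Option ℕ)) (i : ℕ) =>
        g₂ p.1.1 (Nat.pair p.1.2.unpair.1 (Nat.pair p.2.1 i)) :=
      (p₂.comp (Primrec.fst.comp h1) (Primrec₂.natPair.comp (Primrec.fst.comp (hu.comp h1))
        (Primrec₂.natPair.comp (Primrec.fst.comp (Primrec.snd.comp Primrec.fst)) Primrec.snd))).to₂
    have h3 : Primrec₂ fun (q : List Bool × ℕ) (p : ℕ × Option ℕ) =>
        p.2.bind fun i => g₂ q.1 (Nat.pair q.2.unpair.1 (Nat.pair p.1 i)) :=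
      (Primrec.option_bind (Primrec.snd.comp Primrec.snd) h2).to₂
    exact Primrec.nat_rec' (Primrec.snd.comp hu) (p₁.comp Primrec.fst (Primrec.fst.comp hu)) h3
  | rfind _ ih =>
    obtain ⟨g, p, h⟩ := ih
    refine ⟨_, ?_, approximates_rfind h⟩
    refine primrec_firstSome (f := fun q : List Bool × ℕ => _) ?_
      (Primrec.list_length.comp Primrec.fst)
    have hg : Primrec fun q : ℕ × (List Bool × ℕ) => g q.2.1 (Nat.pair q.2.2 q.1) :=
      p.comp (Primrec.fst.comp Primrec.snd)
        (Primrec₂.natPair.comp (Primrec.snd.comp Primrec.snd) Primrec.fst)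
    have hR : PrimrecRel fun (m : ℕ) (q : List Bool × ℕ) =>
        ¬ (g q.1 (Nat.pair q.2 m)).getD 0 = 0 :=
      (PrimrecRel.comp Primrec.eq (Primrec.option_getD.comp hg (Primrec.const 0))
        (Primrec.const 0)).not.primrecRel
    have hsw : Primrec fun q : (List Bool × ℕ) × ℕ => (q.2, q.1) :=
      Primrec.snd.pair Primrec.fst
    have hall : PrimrecPred fun q : (List Bool × ℕ) × ℕ =>
        ∀ m < q.2, ¬ (g q.1.1 (Nat.pair q.1.2 m)).getD 0 = 0 :=
      have h : PrimrecRel fun (n : ℕ) (q : List Bool × ℕ) =>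
          ∀ m < n, ¬ (g q.1 (Nat.pair q.2 m)).getD 0 = 0 :=
        ((PrimrecRel.forall_mem_list hR).comp (Primrec.list_range.comp Primrec.fst)
          Primrec.snd).of_eq (by simp)
      h.comp Primrec.snd Primrec.fst
    exact (Primrec.ite ((PrimrecRel.comp Primrec.eq (hg.comp hsw) (Primrec.const (some 0))).and
      hall) (Primrec.option_some.comp Primrec.snd) (Primrec.const none)).to₂

theorem exists_computes {A B : Set ℕ} (h : SetTuringReducible A B) : ∃ e, Computes e B A := by
  obtain ⟨g, hg, -, happ⟩ := exists_approximates (RecursiveIn.iff_nat.1 h)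
  obtain ⟨e, he⟩ := exists_functional hg
  refine ⟨e, fun x => he B x _ (fun s v hv => ?_) ?_⟩
  · exact Part.mem_some_iff.1 ((happ x v).2 ⟨s, hv⟩)
  · obtain ⟨s, hs⟩ := (happ x (chi A x)).1 (Part.mem_some _)
    exact ⟨s, by rw [hs]; rfl⟩

/-- The code of the initial segment of length `s` of an oracle is computable from the oracle. -/
theorem recursiveIn_restrict (B : Set ℕ) :
    Nat.RecursiveIn {fun x => Part.some (chi B x)} fun s => Part.some (encode (restrict B s)) := by
  classical
  -- The input is ⟨⟨a, ⟨y, i⟩⟩, b⟩, where i codes the segment of length y and b is the oracle's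
  -- answer at y; the bit b is appended.
  have hk : Primrec fun w : ℕ => encode
      ((decode (α := List Bool) w.unpair.1.unpair.2.unpair.2).getD [] ++
        [decide (w.unpair.2 = 1)]) := by
    have h1 : Primrec fun w : ℕ => w.unpair := Primrec.unpair
    refine Primrec.encode.comp (Primrec.list_append.comp (Primrec.option_getD.comp
      (Primrec.decode.comp (Primrec.snd.comp (h1.comp (Primrec.snd.comp
        (h1.comp (Primrec.fst.comp h1)))))) (Primrec.const [])) ?_)
    exact Primrec.list_cons.comp (PrimrecPred.decide (PrimrecRel.comp Primrec.eq
      (Primrec.snd.comp h1) (Primrec.const 1))) (Primrec.const [])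
  have hstep := Nat.RecursiveIn.comp
    (Nat.Primrec.recursiveIn (O := {fun x => Part.some (chi B x)}) (Primrec.nat_iff.1 hk))
    (Nat.RecursiveIn.pair (Nat.Primrec.recursiveIn Nat.Primrec.id)
      (Nat.RecursiveIn.comp (Nat.RecursiveIn.oracle _ rfl)
        (Nat.RecursiveIn.comp Nat.RecursiveIn.left Nat.RecursiveIn.right)))
  have hrec := Nat.RecursiveIn.comp (Nat.RecursiveIn.prec
    (Nat.Primrec.recursiveIn (Nat.Primrec.const (encode ([] : List Bool)))) hstep)
    (Nat.Primrec.recursiveIn (Primrec.nat_iff.1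
      (Primrec₂.natPair.comp (Primrec.const 0) Primrec.id)))
  refine hrec.of_eq fun s => ?_
  simp only [Part.bind_eq_bind, Part.coe_some, Part.bind_some, Nat.unpair_pair, id]
  induction s with
  | zero => simp [restrict]
  | succ s ih =>
    simp only at ih ⊢
    rw [ih, Part.bind_some]
    simp [Seq.seq, restrict_succ, chi_eq_one]

/-- A set is computable from `B` if its elements can be decided, within a primitive recursive
search, by inspecting initial segments of `B`. -/
theorem reducible_of_approx {A B : Set ℕ} {g : List Bool → ℕ → Option ℕ} (hg : Primrec₂ g)
    (h1 : ∀ s x v, g (restrict B s) x = some v → v = chi A x)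
    (h2 : ∀ x, ∃ s, (g (restrict B s) x).isSome) : SetTuringReducible A B := by
  have hdec : Primrec fun w : ℕ =>
      g ((decode (α := List Bool) w.unpair.2).getD []) w.unpair.1 :=
    hg.comp (Primrec.option_getD.comp (Primrec.decode.comp (Primrec.snd.comp Primrec.unpair))
      (Primrec.const [])) (Primrec.fst.comp Primrec.unpair)
  -- Success is coded by 0, the value for which unbounded minimization searches.
  have htest : Primrec fun w : ℕ =>
      if (g ((decode (α := List Bool) w.unpair.2).getD []) w.unpair.1).isSome = true
        then 0 else 1 :=
    Primrec.ite (PrimrecRel.comp Primrec.eq (Primrec.option_isSome.comp hdec) (Primrec.const true))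
      (Primrec.const 0) (Primrec.const 1)
  have hval : Primrec fun w : ℕ =>
      (g ((decode (α := List Bool) w.unpair.2).getD []) w.unpair.1).getD 0 :=
    Primrec.option_getD.comp hdec (Primrec.const 0)
  have hseg := Nat.RecursiveIn.comp (recursiveIn_restrict B) Nat.RecursiveIn.right
  have hpair := Nat.RecursiveIn.pair Nat.RecursiveIn.left hseg
  have hfind := Nat.RecursiveIn.rfind
    (Nat.RecursiveIn.comp (Nat.Primrec.recursiveIn (Primrec.nat_iff.1 htest)) hpair)
  have hfinal := Nat.RecursiveIn.comp
    (Nat.RecursiveIn.comp (Nat.Primrec.recursiveIn (Primrec.nat_iff.1 hval)) hpair)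
    (Nat.RecursiveIn.pair (Nat.Primrec.recursiveIn Nat.Primrec.id) hfind)
  refine RecursiveIn.iff_nat.2 (hfinal.of_eq fun x => ?_)
  classical
  have hs := Nat.find_spec (h2 x)
  have hmin : ∀ {m}, m < Nat.find (h2 x) → ¬ (g (restrict B m) x).isSome := fun hm =>
    Nat.find_min (h2 x) hm
  generalize Nat.find (h2 x) = s at hs hmin
  have hmem : s ∈ Nat.rfind fun n => (fun m : ℕ => decide (m = 0)) <$> Part.some
      (if (g (restrict B n) x).isSome = true then 0 else 1) := by
    refine Nat.mem_rfind.2 ⟨by simp [hs], fun {m} hm => ?_⟩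
    simp [hmin hm]
  obtain ⟨v, hv⟩ := Option.isSome_iff_exists.1 hs
  simp [Seq.seq] at hmem ⊢
  rw [Part.eq_some_iff.2 hmem]
  simp [hv, h1 s x v hv]

theorem Computes.reducible {e : ℕ} {A B : Set ℕ} (h : Computes e B A) :
    SetTuringReducible A B :=
  reducible_of_approx (g := phiStr e)
    (primrec_phiStr (Primrec.const e) Primrec.fst Primrec.snd)
    (fun _ _ _ hv => h.eq_chi hv)
    (fun x => (computes_iff.1 h x).imp fun s hs => by rw [hs]; rfl)

theorem SetTuringReducible.trans {A B C : Set ℕ} (h : SetTuringReducible A B)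
    (h' : SetTuringReducible B C) : SetTuringReducible A C :=
  TuringReducible.trans h h'

/-! ### Closure properties of the arithmetical hierarchy -/

theorem SetTuringReducible.preimage {P J : Set ℕ} {f : ℕ → ℕ} (hf : Primrec f)
    (h : SetTuringReducible P J) : SetTuringReducible (f ⁻¹' P) J := by
  obtain ⟨e, he⟩ := exists_computes h
  refine reducible_of_approx (g := fun σ x => phiStr e σ (f x))
    (primrec_phiStr (Primrec.const e) Primrec.fst (hf.comp Primrec.snd)) ?_ ?_
  · exact fun s x v hv => he.eq_chi hv
  · exact fun x => (computes_iff.1 he (f x)).imp fun s hs => by rw [hs]; rfl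

theorem SetTuringReducible.compl {P J : Set ℕ} (h : SetTuringReducible P J) :
    SetTuringReducible Pᶜ J := by
  classical
  obtain ⟨e, he⟩ := exists_computes h
  refine reducible_of_approx (g := fun σ x => (phiStr e σ x).map fun v => 1 - v)
    (Primrec.option_map (primrec_phiStr (Primrec.const e) Primrec.fst Primrec.snd)
      (Primrec.nat_sub.comp (Primrec.const 1) Primrec.snd).to₂) ?_ ?_
  · intro s x v hv
    obtain ⟨w, hw, rfl⟩ := Option.map_eq_some_iff.1 hv
    rw [he.eq_chi hw]
    by_cases hx : x ∈ P <;> simp [chi, hx]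
  · intro x
    obtain ⟨s, hs⟩ := computes_iff.1 he x
    exact ⟨s, by simp [hs]⟩

theorem SetTuringReducible.union {P Q J : Set ℕ} (hP : SetTuringReducible P J)
    (hQ : SetTuringReducible Q J) : SetTuringReducible (P ∪ Q) J := by
  classical
  obtain ⟨e, he⟩ := exists_computes hP
  obtain ⟨e', he'⟩ := exists_computes hQ
  refine reducible_of_approx
    (g := fun σ x => (phiStr e σ x).bind fun v => (phiStr e' σ x).map fun w => max v w) ?_ ?_ ?_
  · exact Primrec.option_bind (primrec_phiStr (Primrec.const e) Primrec.fst Primrec.snd)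
      (Primrec.option_map (primrec_phiStr (Primrec.const e') (Primrec.fst.comp Primrec.fst)
        (Primrec.snd.comp Primrec.fst))
        (Primrec.nat_max.comp (Primrec.snd.comp Primrec.fst) Primrec.snd).to₂).to₂
  · intro s x v hv
    obtain ⟨a, ha, hv⟩ := Option.bind_eq_some_iff.1 hv
    obtain ⟨b, hb, rfl⟩ := Option.map_eq_some_iff.1 hv
    rw [he.eq_chi ha, he'.eq_chi hb]
    by_cases hx : x ∈ P <;> by_cases hy : x ∈ Q <;> simp [chi, hx, hy]
  · intro x
    obtain ⟨s, hs⟩ := computes_iff.1 he x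
    obtain ⟨t, ht⟩ := computes_iff.1 he' x
    exact ⟨max s t, by
      simp [phiStr_mono (le_max_left s t) hs, phiStr_mono (le_max_right s t) ht]⟩

theorem SetTuringReducible.inter {P Q J : Set ℕ} (hP : SetTuringReducible P J)
    (hQ : SetTuringReducible Q J) : SetTuringReducible (P ∩ Q) J := by
  rw [← compl_compl (P ∩ Q), Set.compl_inter]
  exact (hP.compl.union hQ.compl).compl

theorem IsSigma.preimage {J : Set ℕ} {n : ℕ} {P : Set ℕ} {f : ℕ → ℕ} (hf : Primrec f)
    (h : IsSigma J n P) : IsSigma J n (f ⁻¹' P) := by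
  induction n generalizing P f with
  | zero => exact SetTuringReducible.preimage hf h
  | succ n ih =>
    obtain ⟨Q, hQ, rfl⟩ := h
    refine ⟨(fun z => Nat.pair (f z.unpair.1) z.unpair.2) ⁻¹' Q, ?_, by ext; simp⟩
    exact ih (P := Qᶜ) (Primrec₂.natPair.comp (hf.comp (Primrec.fst.comp Primrec.unpair))
      (Primrec.snd.comp Primrec.unpair)) hQ

theorem IsSigma.succ_of_compl {J : Set ℕ} {n : ℕ} {P : Set ℕ} (h : IsSigma J n Pᶜ) :
    IsSigma J (n + 1) P :=
  ⟨(fun z => z.unpair.1) ⁻¹' P, h.preimage (Primrec.fst.comp Primrec.unpair), by ext; simp⟩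

theorem IsSigma.succ {J : Set ℕ} {n : ℕ} {P : Set ℕ} (h : IsSigma J n P) :
    IsSigma J (n + 1) P := by
  induction n generalizing P with
  | zero => exact IsSigma.succ_of_compl (SetTuringReducible.compl h)
  | succ n ih =>
    obtain ⟨Q, hQ, rfl⟩ := h
    exact ⟨Q, ih hQ, rfl⟩

theorem IsSigma.mono {J : Set ℕ} {n m : ℕ} (hnm : n ≤ m) {P : Set ℕ} (h : IsSigma J n P) :
    IsSigma J m P := by
  induction hnm with
  | refl => exact h
  | step _ ih => exact ih.succ

/-- Both closures are proved together because the complement in the inductive step exchanges them.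
-/
theorem IsSigma.union_inter {J : Set ℕ} {n : ℕ} {P P' : Set ℕ} (h : IsSigma J n P)
    (h' : IsSigma J n P') : IsSigma J n (P ∪ P') ∧ IsSigma J n (P ∩ P') := by
  induction n generalizing P P' with
  | zero => exact ⟨SetTuringReducible.union h h', SetTuringReducible.inter h h'⟩
  | succ n ih =>
    obtain ⟨Q, hQ, rfl⟩ := h
    obtain ⟨Q', hQ', rfl⟩ := h'
    constructor
    · refine ⟨Q ∪ Q', ?_, by ext; simp [exists_or]⟩
      rw [Set.compl_union]
      exact (ih hQ hQ').2
    · have h1 : Primrec fun z : ℕ => z.unpair := Primrec.unpair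
      refine ⟨(fun z => Nat.pair z.unpair.1 z.unpair.2.unpair.1) ⁻¹' Q ∩
        (fun z => Nat.pair z.unpair.1 z.unpair.2.unpair.2) ⁻¹' Q', ?_, ?_⟩
      · rw [Set.compl_inter]
        refine (ih (IsSigma.preimage (P := Qᶜ) ?_ hQ) (IsSigma.preimage (P := Q'ᶜ) ?_ hQ')).1
        · exact Primrec₂.natPair.comp (Primrec.fst.comp h1)
            (Primrec.fst.comp (h1.comp (Primrec.snd.comp h1)))
        · exact Primrec₂.natPair.comp (Primrec.fst.comp h1)
            (Primrec.snd.comp (h1.comp (Primrec.snd.comp h1)))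
      · ext x
        simp only [Set.mem_inter_iff, Set.mem_ofPred_eq, Set.mem_preimage, Nat.unpair_pair]
        constructor
        · rintro ⟨⟨y, hy⟩, z, hz⟩
          exact ⟨Nat.pair y z, by simpa using ⟨hy, hz⟩⟩
        · rintro ⟨w, hy, hz⟩
          exact ⟨⟨_, hy⟩, _, hz⟩

theorem IsSigma.exists_pair {J : Set ℕ} {n : ℕ} {P : Set ℕ} (h : IsSigma J (n + 1) P) :
    IsSigma J (n + 1) {x | ∃ y, Nat.pair x y ∈ P} := by
  obtain ⟨Q, hQ, rfl⟩ := h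
  have h1 : Primrec fun z : ℕ => z.unpair := Primrec.unpair
  refine ⟨(fun z => Nat.pair (Nat.pair z.unpair.1 z.unpair.2.unpair.1) z.unpair.2.unpair.2) ⁻¹' Q,
    IsSigma.preimage (P := Qᶜ) ?_ hQ, ?_⟩
  · exact Primrec₂.natPair.comp (Primrec₂.natPair.comp (Primrec.fst.comp h1)
      (Primrec.fst.comp (h1.comp (Primrec.snd.comp h1))))
      (Primrec.snd.comp (h1.comp (Primrec.snd.comp h1)))
  · ext x
    simp only [Set.mem_ofPred_eq, Set.mem_preimage, Nat.unpair_pair]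
    constructor
    · rintro ⟨y, z, h⟩
      exact ⟨Nat.pair y z, by simpa using h⟩
    · rintro ⟨w, h⟩
      exact ⟨_, _, h⟩

/-! ### Predicates in the arithmetical hierarchy -/

/-- The predicate `P` on a denumerable type is `Σ⁰_n(J)`. -/
def SigmaPred (J : Set ℕ) (n : ℕ) {α : Type*} [Denumerable α] (P : α → Prop) : Prop :=
  IsSigma J n {x | P (ofNat α x)}

/-- The predicate `P` on a denumerable type is `Π⁰_n(J)`. -/
def PiPred (J : Set ℕ) (n : ℕ) {α : Type*} [Denumerable α] (P : α → Prop) : Prop :=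
  SigmaPred J n fun a => ¬ P a

section

variable {J : Set ℕ} {n : ℕ} {α β : Type*} [Denumerable α] [Denumerable β] {P Q : α → Prop}

theorem SigmaPred.congr (h : SigmaPred J n P) (hPQ : ∀ a, P a ↔ Q a) : SigmaPred J n Q := by
  rwa [← show P = Q from funext fun a => propext (hPQ a)]

theorem SigmaPred.comp {f : β → α} (hf : Primrec f) (h : SigmaPred J n P) :
    SigmaPred J n fun b => P (f b) := by
  have : Primrec fun x : ℕ => encode (f (ofNat β x)) :=
    Primrec.encode.comp (hf.comp (Primrec.ofNat β))
  have := IsSigma.preimage this h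
  simpa [SigmaPred, Set.preimage] using this

theorem SigmaPred.mono {m : ℕ} (hnm : n ≤ m) (h : SigmaPred J n P) : SigmaPred J m P :=
  IsSigma.mono hnm h

theorem SigmaPred.or (h : SigmaPred J n P) (h' : SigmaPred J n Q) :
    SigmaPred J n fun a => P a ∨ Q a :=
  (IsSigma.union_inter h h').1

theorem SigmaPred.and (h : SigmaPred J n P) (h' : SigmaPred J n Q) :
    SigmaPred J n fun a => P a ∧ Q a :=
  (IsSigma.union_inter h h').2

theorem SigmaPred.exists {P : α × β → Prop} (h : SigmaPred J (n + 1) P) :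
    SigmaPred J (n + 1) fun a => ∃ b, P (a, b) := by
  have := IsSigma.exists_pair h
  refine (congrArg (IsSigma J (n + 1)) ?_).mp this
  ext x
  simp only [Set.mem_ofPred_eq, prod_ofNat_val, Nat.unpair_pair]
  exact ⟨fun ⟨y, hy⟩ => ⟨_, hy⟩, fun ⟨b, hb⟩ => ⟨encode b, by rwa [ofNat_encode]⟩⟩

theorem SigmaPred.piPred_not (h : SigmaPred J n P) : PiPred J n fun a => ¬ P a :=
  SigmaPred.congr h fun _ => not_not.symm

theorem SigmaPred.piPred_succ (h : SigmaPred J n P) : PiPred J (n + 1) P :=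
  IsSigma.succ_of_compl ((congrArg (IsSigma J n) (by ext; simp)).mp h)

theorem PiPred.sigmaPred_succ (h : PiPred J n P) : SigmaPred J (n + 1) P :=
  IsSigma.succ_of_compl h

theorem PiPred.mono {m : ℕ} (hnm : n ≤ m) (h : PiPred J n P) : PiPred J m P :=
  SigmaPred.mono hnm h

theorem PiPred.and (h : PiPred J n P) (h' : PiPred J n Q) : PiPred J n fun a => P a ∧ Q a :=
  (SigmaPred.or h h').congr fun _ => not_and_or.symm

theorem PiPred.or (h : PiPred J n P) (h' : PiPred J n Q) : PiPred J n fun a => P a ∨ Q a :=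
  (SigmaPred.and h h').congr fun _ => not_or.symm

theorem PiPred.forall {P : α × β → Prop} (h : PiPred J (n + 1) P) :
    PiPred J (n + 1) fun a => ∀ b, P (a, b) :=
  (SigmaPred.exists h).congr fun _ => not_forall.symm

/-- The source of all Σ⁰₁ bounds below: a search through initial segments of the oracle with a
primitive recursive test. -/
theorem sigmaPred_of_primrecRel {r : List Bool → α → Prop} (hr : PrimrecRel r) :
    SigmaPred J 1 fun a => ∃ s, r (restrict J s) a := by
  classical
  refine ⟨{w | r (restrict J w.unpair.2) (ofNat α w.unpair.1)}, ?_, by ext; simp⟩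
  have hu : Primrec fun p : List Bool × ℕ => p.2.unpair := Primrec.unpair.comp Primrec.snd
  -- The answer is given only on the segment of the prescribed length. The values 0 and 1 are
  -- exchanged because it is the complement of the matrix that must be computable.
  refine reducible_of_approx (g := fun σ w => if σ.length = w.unpair.2 then
    some (if r σ (ofNat α w.unpair.1) then 0 else 1) else none) ?_ ?_ ?_
  · have h1 : PrimrecPred fun p : List Bool × ℕ => p.1.length = p.2.unpair.2 :=
      PrimrecRel.comp Primrec.eq (Primrec.list_length.comp Primrec.fst) (Primrec.snd.comp hu)
    have h2 : PrimrecPred fun p : List Bool × ℕ => r p.1 (ofNat α p.2.unpair.1) :=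
      PrimrecRel.comp hr Primrec.fst ((Primrec.ofNat α).comp (Primrec.fst.comp hu))
    exact (Primrec.ite h1 (Primrec.option_some.comp (Primrec.ite h2 (Primrec.const 0)
      (Primrec.const 1))) (Primrec.const none)).to₂
  · intro s x v hv
    split_ifs at hv with h1 h2
    · rw [length_restrict] at h1
      subst h1
      simp [chi, h2, ← Option.some.inj hv]
    · rw [length_restrict] at h1
      subst h1
      simp [chi, h2, ← Option.some.inj hv]
  · exact fun x => ⟨x.unpair.2, by simp [length_restrict]⟩

end

/-! ### Strings coding initial segments of a join -/

/-- The entries of a string at even positions. -/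
def evens (τ : List Bool) : List Bool :=
  (List.range (τ.length / 2)).map fun i => τ.getD (2 * i) false

/-- The entries of a string at odd positions. -/
def odds (τ : List Bool) : List Bool :=
  (List.range (τ.length / 2)).map fun i => τ.getD (2 * i + 1) false

theorem primrec_evens : Primrec evens :=
  Primrec.list_map (Primrec.list_range.comp (Primrec.nat_div.comp Primrec.list_length
    (Primrec.const 2))) ((Primrec.list_getD false).comp Primrec.fst
      (Primrec.nat_double.comp Primrec.snd)).to₂

theorem primrec_odds : Primrec odds :=
  Primrec.list_map (Primrec.list_range.comp (Primrec.nat_div.comp Primrec.list_length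
    (Primrec.const 2))) ((Primrec.list_getD false).comp Primrec.fst
      (Primrec.nat_double_succ.comp Primrec.snd)).to₂

theorem double_mem_join {A B : Set ℕ} {x : ℕ} : 2 * x ∈ join A B ↔ x ∈ A := by
  constructor
  · rintro (⟨y, hy, h⟩ | ⟨y, hy, h⟩)
    · rwa [show x = y by omega]
    · omega
  · exact fun h => Or.inl ⟨x, h, rfl⟩

theorem double_succ_mem_join {A B : Set ℕ} {x : ℕ} : 2 * x + 1 ∈ join A B ↔ x ∈ B := by
  constructor
  · rintro (⟨y, hy, h⟩ | ⟨y, hy, h⟩)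
    · omega
    · rwa [show x = y by omega]
  · exact fun h => Or.inr ⟨x, h, rfl⟩

theorem evens_restrict (A B : Set ℕ) (s : ℕ) :
    evens (restrict (join A B) s) = restrict A (s / 2) := by
  classical
  rw [evens, length_restrict]
  refine List.map_congr_left fun i hi => ?_
  have : 2 * i < s := by have := List.mem_range.1 hi; omega
  rw [List.getD_eq_getElem?_getD, getElem?_restrict _ this]
  simp [double_mem_join]

theorem odds_restrict (A B : Set ℕ) (s : ℕ) :
    odds (restrict (join A B) s) = restrict B (s / 2) := by
  classical
  rw [odds, length_restrict]
  refine List.map_congr_left fun i hi => ?_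
  have : 2 * i + 1 < s := by have := List.mem_range.1 hi; omega
  rw [List.getD_eq_getElem?_getD, getElem?_restrict _ this]
  simp [double_succ_mem_join]

theorem reducible_join_left (A B : Set ℕ) : SetTuringReducible A (join A B) := by
  classical
  refine reducible_of_approx (g := fun σ x => σ[2 * x]?.map Bool.toNat) (Primrec.option_map
    (Primrec.list_getElem?.comp Primrec.fst (Primrec.nat_double.comp Primrec.snd))
    ((Primrec.dom_bool _).comp Primrec.snd).to₂) ?_ ?_
  · intro s x v hv
    obtain ⟨b, hb, rfl⟩ := Option.map_eq_some_iff.1 hv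
    obtain ⟨hi, -⟩ := List.getElem?_eq_some_iff.1 hb
    rw [length_restrict] at hi
    rw [getElem?_restrict _ hi] at hb
    rw [← Option.some.inj hb]
    by_cases h : x ∈ A <;> simp [double_mem_join, chi, h]
  · exact fun x => ⟨2 * x + 1, by simp [getElem?_restrict _ (Nat.lt_succ_self (2 * x))]⟩

theorem reducible_join_right (A B : Set ℕ) : SetTuringReducible B (join A B) := by
  classical
  refine reducible_of_approx (g := fun σ x => σ[2 * x + 1]?.map Bool.toNat) (Primrec.option_map
    (Primrec.list_getElem?.comp Primrec.fst (Primrec.nat_double_succ.comp Primrec.snd))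
    ((Primrec.dom_bool _).comp Primrec.snd).to₂) ?_ ?_
  · intro s x v hv
    obtain ⟨b, hb, rfl⟩ := Option.map_eq_some_iff.1 hv
    obtain ⟨hi, -⟩ := List.getElem?_eq_some_iff.1 hb
    rw [length_restrict] at hi
    rw [getElem?_restrict _ hi] at hb
    rw [← Option.some.inj hb]
    by_cases h : x ∈ B <;> simp [double_succ_mem_join, chi, h]
  · exact fun x => ⟨2 * x + 2, by simp [getElem?_restrict _ (Nat.lt_succ_self (2 * x + 1))]⟩

theorem mem_Phi_iff_evens {e x v : ℕ} {A B : Set ℕ} :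
    v ∈ Phi e A x ↔ ∃ s, phiStr e (evens (restrict (join A B) s)) x = some v := by
  simp only [evens_restrict, mem_Phi_iff]
  exact ⟨fun ⟨s, h⟩ => ⟨2 * s, by simpa using h⟩, fun ⟨s, h⟩ => ⟨_, h⟩⟩

/-! ### Closure properties of ideals -/

theorem reducible_of_finite {F : Set ℕ} (hF : F.Finite) (B : Set ℕ) : SetTuringReducible F B := by
  classical
  have hp : PrimrecPred fun x : ℕ => x ∈ hF.toFinset.toList :=
    (PrimrecRel.exists_mem_list (R := fun a b : ℕ => a = b) Primrec.eq).comp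
      (Primrec.const hF.toFinset.toList) Primrec.id |>.of_eq (by simp)
  refine reducible_of_approx
    (g := fun _ x => some (if x ∈ hF.toFinset.toList then 1 else 0)) ?_ ?_ ?_
  · exact (Primrec.option_some.comp (Primrec.ite (hp.comp Primrec.snd) (Primrec.const 1)
      (Primrec.const 0))).to₂
  · intro s x v hv
    simpa [chi, eq_comm] using hv
  · exact fun x => ⟨0, rfl⟩

theorem reducible_diff_finite (B : Set ℕ) {F : Set ℕ} (hF : F.Finite) :
    SetTuringReducible (B \ F) B :=
  SetTuringReducible.inter (TuringReducible.refl _) (reducible_of_finite hF B).compl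

section

variable {I : Set (Set ℕ)}

theorem IsTuringIdeal.union_mem (hI : IsTuringIdeal I) {U V : Set ℕ} (hU : U ∈ I) (hV : V ∈ I) :
    U ∪ V ∈ I :=
  hI.downward_closed _ (hI.join_closed U hU V hV) _
    ((reducible_join_left U V).union (reducible_join_right U V))

theorem IsTuringIdeal.inter_mem (hI : IsTuringIdeal I) {U V : Set ℕ} (hU : U ∈ I) (hV : V ∈ I) :
    U ∩ V ∈ I :=
  hI.downward_closed _ (hI.join_closed U hU V hV) _
    ((reducible_join_left U V).inter (reducible_join_right U V))

theorem IsTuringIdeal.finite_mem (hI : IsTuringIdeal I) {F : Set ℕ} (hF : F.Finite) : F ∈ I :=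
  let ⟨B, hB⟩ := hI.nonempty
  hI.downward_closed B hB F (reducible_of_finite hF B)

theorem IsTuringIdeal.diff_finite_mem (hI : IsTuringIdeal I) {U F : Set ℕ} (hU : U ∈ I)
    (hF : F.Finite) : U \ F ∈ I :=
  hI.downward_closed U hU _ (reducible_diff_finite U hF)

theorem IsTuringIdeal.univ_mem (hI : IsTuringIdeal I) : Set.univ ∈ I := by
  obtain ⟨B, hB⟩ := hI.nonempty
  refine hI.downward_closed B hB _ ?_
  rw [← Set.compl_empty]
  exact (reducible_of_finite Set.finite_empty B).compl

end

/-! ### Indices of conditions -/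

theorem MathiasCondition.ext' {p q : MathiasCondition} (hD : p.D = q.D) (hS : p.S = q.S) :
    p = q := by
  cases p; cases q; cases hD; cases hS; rfl

theorem finset_eq_of_sum_two_pow {D E : Finset ℕ} (h : ∑ i ∈ D, 2 ^ i = ∑ i ∈ E, 2 ^ i) :
    D = E := by
  rw [← Finset.toFinset_bitIndices_sum_two_pow D, h, Finset.toFinset_bitIndices_sum_two_pow]

section

variable {I : Set (Set ℕ)} {A₀ A₁ : Set ℕ}

theorem IsIndex.unique {p q : MathiasCondition} {c : ℕ} (hp : IsIndex A₀ A₁ p c)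
    (hq : IsIndex A₀ A₁ q c) : p = q := by
  obtain ⟨e₀, e₁, rfl, hp, -⟩ := hp
  obtain ⟨f₀, f₁, h, hq, -⟩ := hq
  rw [Nat.pair_eq_pair, Nat.pair_eq_pair] at h
  obtain ⟨h, rfl, rfl⟩ := h
  exact MathiasCondition.ext' (finset_eq_of_sum_two_pow h) (hp.unique hq)

theorem exists_isIndex (hpair : IsExactPair A₀ A₁ I) (p : MathiasCondition) (hp : p.S ∈ I) :
    ∃ c, IsIndex A₀ A₁ p c := by
  obtain ⟨h₀, h₁⟩ := (hpair _).1 hp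
  obtain ⟨e₀, h₀⟩ := exists_computes h₀
  obtain ⟨e₁, h₁⟩ := exists_computes h₁
  exact ⟨_, e₀, e₁, rfl, h₀, h₁⟩

theorem IsIndex.mem (hpair : IsExactPair A₀ A₁ I) {p : MathiasCondition} {c : ℕ}
    (h : IsIndex A₀ A₁ p c) : p.S ∈ I := by
  obtain ⟨e₀, e₁, -, h₀, h₁⟩ := h
  exact (hpair _).2 ⟨h₀.reducible, h₁.reducible⟩

/-- `c` is the index of some condition. -/
def ValidIndex (A₀ A₁ : Set ℕ) (c : ℕ) : Prop := ∃ p, IsIndex A₀ A₁ p c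

/-- The clauses say that both functionals are total with the same 0-1 values, that the set is
infinite, and that max D < min S. The last uses that the canonical index of D is below 2 ^ x exactly
when all elements of D are below x. -/
theorem validIndex_iff {c : ℕ} : ValidIndex A₀ A₁ c ↔
    ((∀ x, ∃ s,
      phiStr c.unpair.2.unpair.1 (evens (restrict (join A₀ A₁) s)) x =
        phiStr c.unpair.2.unpair.2 (odds (restrict (join A₀ A₁) s)) x ∧
      (phiStr c.unpair.2.unpair.1 (evens (restrict (join A₀ A₁) s)) x = some 0 ∨
        phiStr c.unpair.2.unpair.1 (evens (restrict (join A₀ A₁) s)) x = some 1)) ∧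
    ∀ x, ∃ y, ∃ s, x < y ∧
      phiStr c.unpair.2.unpair.1 (evens (restrict (join A₀ A₁) s)) y = some 1) ∧
    ∀ x, ¬ ∃ s, phiStr c.unpair.2.unpair.1 (evens (restrict (join A₀ A₁) s)) x = some 1 ∧
      2 ^ x ≤ c.unpair.1 := by
  constructor
  · rintro ⟨p, e₀, e₁, rfl, h₀, h₁⟩
    simp only [Nat.unpair_pair]
    refine ⟨⟨fun x => ?_, fun x => ?_⟩, ?_⟩
    · obtain ⟨s, hs⟩ := computes_iff.1 h₀ x
      obtain ⟨t, ht⟩ := computes_iff.1 h₁ x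
      -- A segment of the join of length 2m splits into segments of length m.
      refine ⟨2 * max s t, ?_⟩
      rw [evens_restrict, odds_restrict, Nat.mul_div_cancel_left _ two_pos,
        phiStr_mono (le_max_left s t) hs, phiStr_mono (le_max_right s t) ht]
      refine ⟨rfl, ?_⟩
      by_cases hx : x ∈ p.S
      · exact Or.inr (congrArg some (chi_eq_one.2 hx))
      · exact Or.inl (congrArg some (chi_eq_zero.2 hx))
    · obtain ⟨y, hy, hxy⟩ := p.infinite.exists_gt x
      obtain ⟨s, hs⟩ := mem_Phi_iff_evens.1 (Part.eq_some_iff.1 (h₀ y))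
      rw [chi_eq_one.2 hy] at hs
      exact ⟨y, s, hxy, hs⟩
    · rintro x ⟨s, hs, hx⟩
      rw [evens_restrict] at hs
      have hx' : x ∈ p.S := chi_eq_one.1 (h₀.eq_chi hs).symm
      exact absurd (Nat.geomSum_lt le_rfl fun d hd => p.lt d hd x hx') (not_lt.2 hx)
  · rintro ⟨⟨h1, h2⟩, h3⟩
    have hS : ∃ S : Set ℕ, Computes c.unpair.2.unpair.1 A₀ S ∧
        Computes c.unpair.2.unpair.2 A₁ S := by
      refine ⟨{x | 1 ∈ Phi c.unpair.2.unpair.1 A₀ x}, ?_⟩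
      have key : ∀ x, ∃ v, v = chi {x | 1 ∈ Phi c.unpair.2.unpair.1 A₀ x} x ∧
          v ∈ Phi c.unpair.2.unpair.1 A₀ x ∧ v ∈ Phi c.unpair.2.unpair.2 A₁ x := by
        intro x
        obtain ⟨s, hs, h⟩ := h1 x
        rw [evens_restrict, odds_restrict] at hs
        rw [evens_restrict] at h
        rcases h with h | h
        · refine ⟨0, (chi_eq_zero.2 fun hx => ?_).symm, mem_Phi_iff.2 ⟨_, h⟩,
            mem_Phi_iff.2 ⟨_, hs ▸ h⟩⟩
          exact absurd (Part.mem_unique hx (mem_Phi_iff.2 ⟨_, h⟩)) one_ne_zero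
        · exact ⟨1, (chi_eq_one.2 (mem_Phi_iff.2 ⟨_, h⟩)).symm, mem_Phi_iff.2 ⟨_, h⟩,
            mem_Phi_iff.2 ⟨_, hs ▸ h⟩⟩
      constructor <;> intro x <;> obtain ⟨v, hv, h, h'⟩ := key x <;> rw [← hv]
      · exact Part.eq_some_iff.2 h
      · exact Part.eq_some_iff.2 h'
    obtain ⟨S, h₀, h₁⟩ := hS
    refine ⟨⟨c.unpair.1.bitIndices.toFinset, S, ?_, ?_⟩, c.unpair.2.unpair.1,
      c.unpair.2.unpair.2, ?_, h₀, h₁⟩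
    · refine Set.infinite_of_forall_exists_gt fun x => ?_
      obtain ⟨y, s, hxy, hs⟩ := h2 x
      rw [evens_restrict] at hs
      exact ⟨y, chi_eq_one.1 (h₀.eq_chi hs).symm, hxy⟩
    · intro d hd x hx
      obtain ⟨s, hs⟩ := mem_Phi_iff_evens (B := A₁).1 (Part.eq_some_iff.1 (h₀ x))
      rw [chi_eq_one.2 hx] at hs
      have hlt : c.unpair.1 < 2 ^ x := not_le.1 fun hle => h3 x ⟨s, hs, hle⟩
      have hd : 2 ^ d ≤ c.unpair.1 := Nat.two_pow_le_of_mem_bitIndices (List.mem_toFinset.1 hd)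
      exact (Nat.pow_lt_pow_iff_right one_lt_two).1 (hd.trans_lt hlt)
    · simp

/-- The first two clauses of `validIndex_iff` have the form ∀∃; the third is Π⁰₁. -/
theorem piPred_validIndex : PiPred (join A₀ A₁) 2 (ValidIndex A₀ A₁) := by
  have hc : Primrec fun q : List Bool × (ℕ × ℕ) => q.2.1.unpair :=
    Primrec.unpair.comp (Primrec.fst.comp Primrec.snd)
  have hi : Primrec fun q : List Bool × (ℕ × ℕ) => q.2.1.unpair.2.unpair :=
    Primrec.unpair.comp (Primrec.snd.comp hc)
  have hx : Primrec fun q : List Bool × (ℕ × ℕ) => q.2.2 := Primrec.snd.comp Primrec.snd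
  have hφ₀ := primrec_phiStr (Primrec.fst.comp hi) (primrec_evens.comp Primrec.fst) hx
  have hφ₁ := primrec_phiStr (Primrec.snd.comp hi) (primrec_odds.comp Primrec.fst) hx
  have hpow : Primrec₂ fun a b : ℕ => a ^ b := Primrec₂.unpaired'.1 Nat.Primrec.pow
  have h1 := sigmaPred_of_primrecRel (J := join A₀ A₁) (PrimrecPred.primrecRel
    ((PrimrecRel.comp Primrec.eq hφ₀ hφ₁).and
      ((PrimrecRel.comp Primrec.eq hφ₀ (Primrec.const (some 0))).or
        (PrimrecRel.comp Primrec.eq hφ₀ (Primrec.const (some 1))))))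
  have h3 := sigmaPred_of_primrecRel (J := join A₀ A₁) (PrimrecPred.primrecRel
    ((PrimrecRel.comp Primrec.eq hφ₀ (Primrec.const (some 1))).and
      (PrimrecRel.comp Primrec.nat_le (hpow.comp (Primrec.const 2) hx) (Primrec.fst.comp hc))))
  have hy : Primrec fun q : List Bool × ((ℕ × ℕ) × ℕ) => q.2.2 := Primrec.snd.comp Primrec.snd
  have hcx : Primrec fun q : List Bool × ((ℕ × ℕ) × ℕ) => q.2.1 := Primrec.fst.comp Primrec.snd
  have h2 := sigmaPred_of_primrecRel (J := join A₀ A₁) (PrimrecPred.primrecRel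
    ((PrimrecRel.comp Primrec.nat_lt (Primrec.snd.comp hcx) hy).and
      (PrimrecRel.comp Primrec.eq (primrec_phiStr (Primrec.fst.comp (Primrec.unpair.comp
        (Primrec.snd.comp (Primrec.unpair.comp (Primrec.fst.comp hcx)))))
        (primrec_evens.comp Primrec.fst) hy) (Primrec.const (some 1)))))
  have h := ((h1.piPred_succ.forall).and (h2.exists.piPred_succ.forall)).and
    ((h3.piPred_not.mono one_le_two).forall)
  exact SigmaPred.congr h fun c => not_congr validIndex_iff.symm

end

section

variable {I : Set (Set ℕ)} {A₀ A₁ : Set ℕ}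

/-! ### Definable collections of conditions -/

/-- Being an index is Π⁰₂, hence Σ⁰₃, so from level 3 on a definition needs to be right only on
indices of conditions. -/
theorem isSigmaCollection_of_sigmaPred (hpair : IsExactPair A₀ A₁ I) {n : ℕ} (hn : 3 ≤ n)
    {C : Set MathiasCondition} (hC : ∀ p ∈ C, p.S ∈ I) {Q : ℕ → Prop}
    (hQ : SigmaPred (join A₀ A₁) n Q)
    (hCQ : ∀ p c, p.S ∈ I → IsIndex A₀ A₁ p c → (p ∈ C ↔ Q c)) :
    IsSigmaCollection I A₀ A₁ n C := by
  refine ⟨hC, ?_⟩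
  have h := (piPred_validIndex (A₀ := A₀) (A₁ := A₁)).sigmaPred_succ.mono hn |>.and hQ
  change SigmaPred (join A₀ A₁) n fun c => ∃ p ∈ C, IsIndex A₀ A₁ p c
  refine h.congr fun c => ?_
  constructor
  · rintro ⟨⟨p, hp⟩, hc⟩
    exact ⟨p, (hCQ p c (hp.mem hpair) hp).2 hc, hp⟩
  · rintro ⟨p, hpC, hp⟩
    exact ⟨⟨p, hp⟩, (hCQ p c (hC p hpC) hp).1 hpC⟩

theorem isSigmaCollection_finite_part (hpair : IsExactPair A₀ A₁ I) {n : ℕ} (hn : 3 ≤ n)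
    {R : ℕ → ℕ → Prop} (hR : PrimrecRel R) :
    IsSigmaCollection I A₀ A₁ n {p | p.S ∈ I ∧ ∃ l, R l (∑ i ∈ p.D, 2 ^ i)} := by
  have hQ : SigmaPred (join A₀ A₁) 1 fun c : ℕ => ∃ l, R l c.unpair.1 := by
    -- Only the length of the oracle segment matters; it ranges over all numbers and serves as the
    -- witness l.
    have h : PrimrecRel fun (σ : List Bool) (c : ℕ) => R σ.length c.unpair.1 :=
      (PrimrecRel.comp hR (Primrec.list_length.comp Primrec.fst)
        (Primrec.fst.comp (Primrec.unpair.comp Primrec.snd))).primrecRel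
    refine (sigmaPred_of_primrecRel h).congr fun c => ?_
    simp only [length_restrict]
  refine isSigmaCollection_of_sigmaPred hpair hn (fun p hp => hp.1) (hQ.mono (by omega)) ?_
  rintro p c hp ⟨e₀, e₁, rfl, -⟩
  simp [hp]

/-- The string coded by a number. -/
def strOfNat (k : ℕ) : List Bool := (decode k).getD []

theorem strOfNat_encode (σ : List Bool) : strOfNat (encode σ) = σ := by
  simp [strOfNat]

theorem primrec_strOfNat : Primrec strOfNat :=
  Primrec.option_getD.comp Primrec.decode (Primrec.const [])

/-- Within the bounds set by the initial segment `τ` of a join, the string coded by `k` is an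
initial segment of the set computed by `i` from the left half, and the `e`-th functional on this
string agrees at `x` with the `a`-th functional on `τ`. -/
def Agrees (i e a x k : ℕ) (τ : List Bool) : Prop :=
  ((List.range (strOfNat k).length).map (phiStr i (evens τ)) =
      (strOfNat k).map (fun b => some b.toNat) ∧
    phiStr e (strOfNat k) x = phiStr a τ x) ∧ (phiStr e (strOfNat k) x).isSome

theorem primrecPred_agrees {α : Type*} [Primcodable α] {i e a x k : α → ℕ} {τ : α → List Bool}
    (hi : Primrec i) (he : Primrec e) (ha : Primrec a) (hx : Primrec x) (hk : Primrec k)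
    (hτ : Primrec τ) : PrimrecPred fun q => Agrees (i q) (e q) (a q) (x q) (k q) (τ q) := by
  have hσ := primrec_strOfNat.comp hk
  have hφ := primrec_phiStr he hσ hx
  refine PrimrecPred.and (PrimrecPred.and (PrimrecRel.comp Primrec.eq ?_ ?_)
    (PrimrecRel.comp Primrec.eq hφ (primrec_phiStr ha hτ hx)))
    (PrimrecRel.comp Primrec.eq (Primrec.option_isSome.comp hφ) (Primrec.const true))
  · exact Primrec.list_map (Primrec.list_range.comp (Primrec.list_length.comp hσ))
      (primrec_phiStr (hi.comp Primrec.fst) (primrec_evens.comp (hτ.comp Primrec.fst))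
        Primrec.snd).to₂
  · exact Primrec.list_map hσ ((Primrec.dom_bool fun b => some b.toNat).comp Primrec.snd).to₂

/-- A computation with oracle U uses a finite segment of U, which can be guessed as k and verified
bit by bit through i. Thus Φ_e^U(x) = A(x) becomes Σ⁰₁ in the join. -/
theorem mem_Phi_of_computes_iff {e i a x : ℕ} {A U : Set ℕ} (hi : Computes i A₀ U)
    (ha : Computes a (join A₀ A₁) A) :
    (∃ k s, Agrees i e a x k (restrict (join A₀ A₁) s)) ↔ chi A x ∈ Phi e U x := by
  classical
  have hbit : ∀ y, chi U y = (decide (y ∈ U)).toNat := fun y => by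
    by_cases h : y ∈ U <;> simp [chi, h]
  constructor
  · rintro ⟨k, s, ⟨h1, h2⟩, h3⟩
    generalize strOfNat k = σ at h1 h2 h3
    obtain ⟨v, hv⟩ := Option.isSome_iff_exists.1 h3
    have hσ : σ = restrict U σ.length := by
      refine eq_restrict fun j hj => ?_
      have h := congrArg (fun l => l[j]?) h1
      simp only [List.getElem?_map, List.getElem?_range hj, List.getElem?_eq_getElem hj,
        Option.map_some, Option.some.injEq, evens_restrict] at h ⊢
      have := hi.eq_chi h
      rw [hbit] at this
      generalize σ[j] = b at this ⊢
      by_cases hU : j ∈ U <;> cases b <;> simp_all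
    rw [mem_Phi_iff, ← ha.eq_chi (h2.symm.trans hv)]
    exact ⟨_, hσ ▸ hv⟩
  · intro h
    obtain ⟨l, hl⟩ := mem_Phi_iff.1 h
    obtain ⟨t, ht⟩ := computes_iff.1 ha x
    obtain ⟨u, hu⟩ := exists_uniform_bound
      (P := fun m s => phiStr i (restrict A₀ s) m = some (chi U m))
      (fun m s t hst => phiStr_mono hst) (n := l) (fun m _ => computes_iff.1 hi m)
    refine ⟨encode (restrict U l), max t (2 * u), ?_⟩
    rw [Agrees, strOfNat_encode, hl, phiStr_mono (le_max_left _ _) ht, length_restrict]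
    refine ⟨⟨?_, rfl⟩, rfl⟩
    rw [show restrict U l = (List.range l).map fun j => decide (j ∈ U) from rfl, List.map_map]
    refine List.map_congr_left fun m hm => ?_
    rw [evens_restrict, phiStr_mono (by omega) (hu m (List.mem_range.1 hm)), hbit]
    rfl

/-- The infinite sets in `I` are the reservoirs of conditions with empty finite part, whose
canonical index is 0, so the quantifier over sets becomes one over i. The alternatives are: i is no
index, its set is not contained in the reservoir, or the computation succeeds everywhere. -/
theorem hereditarilyUniformlyComputing_iff (hpair : IsExactPair A₀ A₁ I) {A : Set ℕ} {a : ℕ}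
    (ha : Computes a (join A₀ A₁) A) {p : MathiasCondition} {c : ℕ} (hp : IsIndex A₀ A₁ p c) :
    HereditarilyUniformlyComputing I A p.S ↔ ∃ e, ∀ i,
      (¬ ValidIndex A₀ A₁ (Nat.pair 0 i) ∨
        ∃ x s, phiStr i.unpair.1 (evens (restrict (join A₀ A₁) s)) x = some 1 ∧
          phiStr c.unpair.2.unpair.1 (evens (restrict (join A₀ A₁) s)) x = some 0) ∨
      ∀ x, ∃ k s, Agrees i.unpair.1 e a x k (restrict (join A₀ A₁) s) := by
  obtain ⟨c₀, c₁, rfl, hc₀, hc₁⟩ := hp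
  simp only [Nat.unpair_pair]
  refine exists_congr fun e => ?_
  constructor
  · intro h i
    by_cases hi : ValidIndex A₀ A₁ (Nat.pair 0 i)
    · obtain ⟨q, hq⟩ := hi
      have hqI := hq.mem hpair
      obtain ⟨i₀, i₁, hii, hi₀, hi₁⟩ := hq
      obtain rfl := (Nat.pair_eq_pair.1 hii).2
      simp only [Nat.unpair_pair]
      by_cases hsub : q.S ⊆ p.S
      · right
        intro x
        rw [mem_Phi_of_computes_iff hi₀ ha, h q.S hqI hsub q.infinite x]
        exact Part.mem_some _
      · left; right
        obtain ⟨x, hx, hx'⟩ := Set.not_subset.1 hsub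
        obtain ⟨s, hs⟩ := computes_iff.1 hi₀ x
        obtain ⟨t, ht⟩ := computes_iff.1 hc₀ x
        refine ⟨x, 2 * max s t, ?_⟩
        rw [evens_restrict, Nat.mul_div_cancel_left _ two_pos, phiStr_mono (le_max_left s t) hs,
          phiStr_mono (le_max_right s t) ht, chi_eq_one.2 hx, chi_eq_zero.2 hx']
        exact ⟨rfl, rfl⟩
    · exact Or.inl (Or.inl hi)
  · intro h T hT hsub hinf x
    obtain ⟨c, hc⟩ := exists_isIndex hpair ⟨∅, T, hinf, by simp⟩ hT
    have hv : ValidIndex A₀ A₁ c := ⟨_, hc⟩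
    obtain ⟨i₀, i₁, rfl, hi₀, hi₁⟩ := hc
    rcases h (Nat.pair i₀ i₁) with (h | ⟨x, s, h1, h0⟩) | h
    · exact absurd hv h
    · rw [evens_restrict] at h1 h0
      rw [Nat.unpair_pair] at h1
      have h1 := hi₀.eq_chi h1
      have h0 := hc₀.eq_chi h0
      exact absurd (hsub (chi_eq_one.1 h1.symm)) (chi_eq_zero.1 h0.symm)
    · simp only [Nat.unpair_pair] at h
      exact Part.eq_some_iff.2 ((mem_Phi_of_computes_iff hi₀ ha).1 (h x))

/-- The disjuncts are Σ⁰₂, Σ⁰₁ and Π⁰₂, so all are Π⁰₃, and the prefix ∃e ∀i yields Σ⁰₄. This is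
where level 4 is needed. -/
theorem isSigmaCollection_hereditarilyUniformlyComputing (hpair : IsExactPair A₀ A₁ I) {n : ℕ}
    (hn : 4 ≤ n) {A : Set ℕ} (hA : SetTuringReducible A (join A₀ A₁)) :
    IsSigmaCollection I A₀ A₁ n {p | p.S ∈ I ∧ HereditarilyUniformlyComputing I A p.S} := by
  obtain ⟨a, ha⟩ := exists_computes hA
  refine isSigmaCollection_of_sigmaPred hpair (by omega) (fun p hp => hp.1) ?_
    (fun p c hp hc => (and_iff_right hp).trans (hereditarilyUniformlyComputing_iff hpair ha hc))
  have hfst {α β γ : Type} [Primcodable α] [Primcodable β] [Primcodable γ] {f : α → β × γ}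
      (hf : Primrec f) : Primrec fun q => (f q).1 := Primrec.fst.comp hf
  have hsnd {α β γ : Type} [Primcodable α] [Primcodable β] [Primcodable γ] {f : α → β × γ}
      (hf : Primrec f) : Primrec fun q => (f q).2 := Primrec.snd.comp hf
  have h1 : PiPred (join A₀ A₁) 3 fun z : (ℕ × ℕ) × ℕ => ¬ ValidIndex A₀ A₁ (Nat.pair 0 z.2) :=
    SigmaPred.piPred_succ (SigmaPred.comp (P := fun c => ¬ ValidIndex A₀ A₁ c)
      (Primrec₂.natPair.comp (Primrec.const 0) Primrec.snd) piPred_validIndex)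
  have h2 : SigmaPred (join A₀ A₁) 1 fun w : ((ℕ × ℕ) × ℕ) × ℕ => ∃ s,
      phiStr w.1.2.unpair.1 (evens (restrict (join A₀ A₁) s)) w.2 = some 1 ∧
        phiStr w.1.1.1.unpair.2.unpair.1 (evens (restrict (join A₀ A₁) s)) w.2 = some 0 := by
    have hw : Primrec fun q : List Bool × (((ℕ × ℕ) × ℕ) × ℕ) => q.2 := Primrec.snd
    have hτ : Primrec fun q : List Bool × (((ℕ × ℕ) × ℕ) × ℕ) => evens q.1 :=
      primrec_evens.comp Primrec.fst
    exact sigmaPred_of_primrecRel (PrimrecPred.primrecRel (PrimrecPred.and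
      (PrimrecRel.comp Primrec.eq (primrec_phiStr
        (hfst (Primrec.unpair.comp (hsnd (hfst hw)))) hτ (hsnd hw)) (Primrec.const _))
      (PrimrecRel.comp Primrec.eq (primrec_phiStr (hfst (Primrec.unpair.comp
        (hsnd (Primrec.unpair.comp (hfst (hfst (hfst hw))))))) hτ (hsnd hw)) (Primrec.const _))))
  have h3 : SigmaPred (join A₀ A₁) 1 fun w : (((ℕ × ℕ) × ℕ) × ℕ) × ℕ => ∃ s,
      Agrees w.1.1.2.unpair.1 w.1.1.1.2 a w.1.2 w.2 (restrict (join A₀ A₁) s) := by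
    have hw : Primrec fun q : List Bool × ((((ℕ × ℕ) × ℕ) × ℕ) × ℕ) => q.2 := Primrec.snd
    exact sigmaPred_of_primrecRel (PrimrecPred.primrecRel (primrecPred_agrees
      (hfst (Primrec.unpair.comp (hsnd (hfst (hfst hw))))) (hsnd (hfst (hfst (hfst hw))))
      (Primrec.const a) (hsnd (hfst hw)) (hsnd hw) Primrec.fst))
  exact (((h1.or (h2.exists.mono one_le_two).piPred_succ).or
    (h3.exists.piPred_succ.forall.mono (Nat.le_succ 2))).forall).sigmaPred_succ.exists.mono hn

end

section

variable {I : Set (Set ℕ)} {A₀ A₁ A G : Set ℕ} {n : ℕ}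

/-! ### Generic sets compute what is uniformly computable -/

/-- The condition obtained from `(D, V)`, for `u ∈ V`, by moving the elements of `V` up to `u` to
the finite part. -/
theorem exists_extension_upto (hI : IsTuringIdeal I) (E : Finset ℕ) {V : Set ℕ} (hV : V ∈ I)
    (hinf : V.Infinite) (u : ℕ) :
    ∃ q : MathiasCondition, q.S ∈ I ∧ q.S ⊆ V ∧ (∀ x ∈ q.S, u < x) ∧
      ∀ x, x ∈ q.D ↔ x ∈ E ∨ x ∈ V ∧ x ≤ u := by
  classical
  -- Elements of `E` may exceed u, and the new reservoir has to lie above them as well.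
  have hfin : {x | x ≤ max u (E.sup id)}.Finite := Set.finite_le_nat _
  refine ⟨⟨E ∪ (Finset.range (u + 1)).filter (· ∈ V), V \ {x | x ≤ max u (E.sup id)},
    hinf.sdiff hfin, ?_⟩, hI.diff_finite_mem hV hfin, Set.sdiff_subset, ?_, ?_⟩
  · rintro d hd s ⟨-, hs⟩
    rw [Set.mem_ofPred_eq, not_le, max_lt_iff] at hs
    rw [Finset.mem_union, Finset.mem_filter, Finset.mem_range] at hd
    rcases hd with hd | ⟨hd, -⟩
    · exact (Finset.le_sup (f := id) hd).trans_lt hs.2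
    · omega
  · rintro x ⟨-, hs⟩
    rw [Set.mem_ofPred_eq, not_le, max_lt_iff] at hs
    exact hs.1
  · intro x
    rw [Finset.mem_union, Finset.mem_filter, Finset.mem_range, Nat.lt_succ_iff, and_comm (a := x ≤ u)]

theorem two_pow_le_sum {D : Finset ℕ} {u : ℕ} (h : u ∈ D) : 2 ^ u ≤ ∑ i ∈ D, 2 ^ i :=
  Finset.single_le_sum (f := fun i => 2 ^ i) (fun _ _ => Nat.zero_le _) h

theorem exists_ge_of_two_pow_le_sum {D : Finset ℕ} {u : ℕ} (h : 2 ^ u ≤ ∑ i ∈ D, 2 ^ i) :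
    ∃ x ∈ D, u ≤ x := by
  by_contra! hlt
  exact absurd (Nat.geomSum_lt le_rfl hlt) (not_lt.2 h)

theorem primrec_two_pow : Primrec fun k : ℕ => 2 ^ k :=
  (Primrec₂.unpaired'.1 Nat.Primrec.pow).comp (Primrec.const 2) Primrec.id

theorem IsGeneric.infinite (hI : IsTuringIdeal I) (hpair : IsExactPair A₀ A₁ I) (hn : 3 ≤ n)
    (hG : IsGeneric I A₀ A₁ n G) : G.Infinite := by
  refine Set.infinite_of_forall_exists_gt fun k => ?_
  have hR : PrimrecRel fun (_ : ℕ) (d : ℕ) => 2 ^ (k + 1) ≤ d :=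
    (PrimrecRel.comp Primrec.nat_le (Primrec.const (2 ^ (k + 1))) Primrec.snd).primrecRel
  rcases hG _ (isSigmaCollection_finite_part hpair hn hR) with
    ⟨p, ⟨-, -, hp⟩, hGp⟩ | ⟨p, hpI, hGp, hav⟩
  · obtain ⟨x, hx, hk⟩ := exists_ge_of_two_pow_le_sum hp
    exact ⟨x, hGp.1 x hx, hk⟩
  · obtain ⟨u, huS, hku⟩ := p.infinite.exists_gt k
    obtain ⟨q, hqI, hqS, -, hqD⟩ := exists_extension_upto hI p.D hpI p.infinite u
    refine absurd ⟨?_, fun x hx => ((hqD x).1 hx).imp_right And.left, hqS⟩ (hav q ⟨hqI, 0, ?_⟩)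
    rotate_left
    · exact fun x hx => (hqD x).2 (Or.inl hx)
    · exact (Nat.pow_le_pow_right two_pos hku).trans
        (two_pow_le_sum ((hqD u).2 (Or.inr ⟨huS, le_rfl⟩)))

/-- The initial segment of length `l` of the finite set with canonical index `d`, without the
elements of `F`. -/
def segDiff (F : List ℕ) (d l : ℕ) : List Bool :=
  (List.range l).map fun i => decide (d / 2 ^ i % 2 = 1 ∧ ¬ i ∈ F)

theorem primrec_segDiff (F : List ℕ) : Primrec₂ (segDiff F) := by
  have hF : PrimrecPred fun x : ℕ => x ∈ F :=
    (PrimrecRel.exists_mem_list (R := fun a b : ℕ => a = b) Primrec.eq).comp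
      (Primrec.const F) Primrec.id |>.of_eq (by simp)
  have h : PrimrecPred fun q : (ℕ × ℕ) × ℕ => q.1.1 / 2 ^ q.2 % 2 = 1 ∧ ¬ q.2 ∈ F :=
    PrimrecPred.and (PrimrecRel.comp Primrec.eq (Primrec.nat_mod.comp (Primrec.nat_div.comp
    (Primrec.fst.comp Primrec.fst) (primrec_two_pow.comp Primrec.snd)) (Primrec.const 2))
    (Primrec.const 1)) (PrimrecPred.not (hF.comp Primrec.snd))
  exact Primrec.list_map (Primrec.list_range.comp Primrec.snd) h.decide.to₂

theorem segDiff_sum (F D : Finset ℕ) (l : ℕ) :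
    segDiff F.toList (∑ i ∈ D, 2 ^ i) l = restrict (↑D \ ↑F) l := by
  classical
  refine List.map_congr_left fun i _ => ?_
  have : (∑ i ∈ D, 2 ^ i) / 2 ^ i % 2 = 1 ↔ i ∈ D := by
    rw [← decide_eq_true_iff (p := _ = 1), ← Nat.testBit_eq_decide_div_mod_eq, ← Nat.mem_bitIndices,
      ← List.mem_toFinset, Finset.toFinset_bitIndices_sum_two_pow]
  rw [decide_eq_decide, this, Finset.mem_toList]
  simp

/-- Genericity is applied to the conditions whose finite part, without `p₀.D`, already makes the
functional converge at x. -/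
theorem IsGeneric.exists_phiStr (hI : IsTuringIdeal I) (hpair : IsExactPair A₀ A₁ I) (hn : 3 ≤ n)
    (hG : IsGeneric I A₀ A₁ n G) {p₀ : MathiasCondition} (hp₀I : p₀.S ∈ I)
    (hGp₀ : Satisfies G p₀) {e : ℕ}
    (he : ∀ T ∈ I, T ⊆ p₀.S → T.Infinite → Computes e T A) (x : ℕ) :
    ∃ s, phiStr e (restrict (G \ ↑p₀.D) s) x = some (chi A x) := by
  -- The clause 2 ^ l ≤ d puts an element at or above l into the finite part. The reservoir then
  -- lies above l, so the finite part fixes the first l bits of `G`.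
  have hR : PrimrecRel fun (l d : ℕ) =>
      2 ^ l ≤ d ∧ (phiStr e (segDiff p₀.D.toList d l) x).isSome = true :=
    (PrimrecPred.and (PrimrecRel.comp Primrec.nat_le (primrec_two_pow.comp Primrec.fst)
      Primrec.snd) (PrimrecRel.comp Primrec.eq (Primrec.option_isSome.comp (primrec_phiStr
        (Primrec.const e) ((primrec_segDiff _).comp Primrec.snd Primrec.fst) (Primrec.const x)))
        (Primrec.const true))).primrecRel
  have hsub : ∀ {E : Finset ℕ}, (∀ y ∈ E, y ∈ G) → (↑E \ ↑p₀.D : Set ℕ) ⊆ p₀.S := by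
    rintro E hE y ⟨hyE, hy⟩
    exact (hGp₀.2 y (hE y hyE)).resolve_left hy
  have hfin : ∀ E : Finset ℕ, (↑E \ ↑p₀.D : Set ℕ) ∈ I := fun E =>
    hI.finite_mem (E.finite_toSet.sdiff)
  rcases hG _ (isSigmaCollection_finite_part hpair hn hR) with
    ⟨p, ⟨hpI, l, hl, hp⟩, hGp⟩ | ⟨p, hpI, hGp, hav⟩
  · rw [segDiff_sum] at hp
    obtain ⟨v, hv⟩ := Option.isSome_iff_exists.1 hp
    obtain ⟨m, hm, hlm⟩ := exists_ge_of_two_pow_le_sum hl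
    have h1 : restrict (G \ ↑p₀.D) l = restrict (↑p.D \ ↑p₀.D) l := by
      refine restrict_congr fun i hi => and_congr_left fun _ => ⟨fun h => ?_, hGp.1 i⟩
      refine (hGp.2 i h).resolve_right fun hS => ?_
      have := p.lt m hm i hS
      omega
    -- Completing the finite part by a tail of `p₀.S` gives a set in `I` to which `he` applies, with
    -- the same first l bits.
    have hU : (↑p.D \ ↑p₀.D ∪ p₀.S \ {y | y < l} : Set ℕ) ∈ I :=
      hI.union_mem (hfin _) (hI.diff_finite_mem hp₀I (Set.finite_lt_nat l))
    have h2 : restrict (↑p.D \ ↑p₀.D ∪ p₀.S \ {y | y < l}) l = restrict (↑p.D \ ↑p₀.D) l :=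
      restrict_congr fun i hi => ⟨fun h => h.resolve_right fun h => h.2 hi, Or.inl⟩
    have hc := he _ hU (Set.union_subset (hsub hGp.1) Set.sdiff_subset)
      ((p₀.infinite.sdiff (Set.finite_lt_nat l)).mono Set.subset_union_right)
    refine ⟨l, ?_⟩
    rw [← hc.eq_chi (h2.symm ▸ hv), h1]
    exact hv
  · exfalso
    -- `G` is infinite and, apart from two finite sets, contained in both reservoirs.
    have hVinf : (p.S ∩ p₀.S).Infinite := by
      refine ((hG.infinite hI hpair hn).sdiff (p.D ∪ p₀.D).finite_toSet).mono ?_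
      rintro y ⟨hy, hyD⟩
      rw [Finset.mem_coe, Finset.mem_union, not_or] at hyD
      exact ⟨(hGp.2 y hy).resolve_left hyD.1, (hGp₀.2 y hy).resolve_left hyD.2⟩
    have hVI := hI.inter_mem hpI hp₀I
    have hc := he _ (hI.union_mem (hfin p.D) hVI)
      (Set.union_subset (hsub hGp.1) Set.inter_subset_right) (hVinf.mono Set.subset_union_right)
    obtain ⟨s, hs⟩ := computes_iff.1 hc x
    -- Moving the reservoir up to u into the finite part preserves the convergent computation, and u
    -- itself witnesses the size clause with l = u.
    obtain ⟨u, hu, hsu⟩ := hVinf.exists_gt s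
    obtain ⟨q, hqI, hqS, -, hqD⟩ := exists_extension_upto hI p.D hVI hVinf u
    refine hav q ⟨hqI, u, two_pow_le_sum ((hqD u).2 (Or.inr ⟨hu, le_rfl⟩)), ?_⟩
      ⟨fun y hy => (hqD y).2 (Or.inl hy), fun y hy => ((hqD y).1 hy).imp_right fun h => h.1.1,
        hqS.trans Set.inter_subset_left⟩
    have : restrict (↑q.D \ ↑p₀.D) u = restrict (↑p.D \ ↑p₀.D ∪ p.S ∩ p₀.S) u := by
      refine restrict_congr fun i hi => ?_
      have hlt : i ∈ p₀.S → i ∉ p₀.D := fun hS hD => lt_irrefl i (p₀.lt i hD i hS)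
      simp only [Set.mem_sdiff, Finset.mem_coe, Set.mem_union, hqD, Set.mem_inter_iff]
      have := hi.le
      tauto
    rw [segDiff_sum, this, phiStr_mono hsu.le hs]
    rfl

theorem IsGeneric.reducible (hI : IsTuringIdeal I) (hpair : IsExactPair A₀ A₁ I) (hn : 4 ≤ n)
    (hG : IsGeneric I A₀ A₁ n G)
    (h : ∀ S ∈ I, S.Infinite → ∃ T ∈ I, T ⊆ S ∧ T.Infinite ∧
      HereditarilyUniformlyComputing I A T) : SetTuringReducible A G := by
  -- An infinite T in `I` is a subset of itself, so it computes `A`.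
  have hA : SetTuringReducible A (join A₀ A₁) := by
    obtain ⟨T, hT, -, hinf, e, he⟩ := h _ hI.univ_mem Set.infinite_univ
    exact ((he T hT subset_rfl hinf).reducible.trans ((hpair T).1 hT).1).trans
      (reducible_join_left A₀ A₁)
  rcases hG _ (isSigmaCollection_hereditarilyUniformlyComputing hpair hn hA) with
    ⟨p, ⟨hpI, e, he⟩, hGp⟩ | ⟨p, hpI, hGp, hav⟩
  · have key := hG.exists_phiStr hI hpair (by omega) hpI hGp he
    exact (computes_iff.2 key).reducible.trans (reducible_diff_finite G p.D.finite_toSet)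
  · obtain ⟨T, hT, hTS, hinf, hTA⟩ := h p.S hpI p.infinite
    exact absurd ⟨subset_rfl, fun x hx => Or.inl hx, hTS⟩
      (hav ⟨p.D, T, hinf, fun d hd s hs => p.lt d hd s (hTS hs)⟩ ⟨hT, hTA⟩)

/-! ### Construction of generic sets -/

theorem MathiasCondition.Extends.refl (p : MathiasCondition) : p.Extends p :=
  ⟨subset_rfl, fun _ hx => Or.inl hx, subset_rfl⟩

theorem MathiasCondition.Extends.trans {p q r : MathiasCondition} (h : r.Extends q)
    (h' : q.Extends p) : r.Extends p := by
  refine ⟨h'.1.trans h.1, fun x hx => ?_, h.2.2.trans h'.2.2⟩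
  rcases h.2.1 x hx with hx | hx
  · exact h'.2.1 x hx
  · exact Or.inr (h'.2.2 hx)

/-- Countably many requirements, each of which can be forced below every condition extending `p`,
can be met simultaneously. -/
theorem exists_forall_satisfies {ι : Type*} [Countable ι] (p : MathiasCondition) (hp : p.S ∈ I)
    (R : ι → MathiasCondition → Prop)
    (hR : ∀ k q, q.S ∈ I → q.Extends p → ∃ r : MathiasCondition, r.S ∈ I ∧ r.Extends q ∧ R k r) :
    ∃ G, ∀ k, ∃ q : MathiasCondition, q.S ∈ I ∧ Satisfies G q ∧ R k q := by
  rcases isEmpty_or_nonempty ι with hι | hι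
  · exact ⟨∅, fun k => hι.elim k⟩
  obtain ⟨f, hf⟩ := exists_surjective_nat ι
  let P := {q : MathiasCondition // q.S ∈ I ∧ q.Extends p}
  have step : ∀ (k : ι) (q : P), ∃ r : P, r.1.Extends q.1 ∧ R k r.1 := by
    rintro k ⟨q, hqI, hq⟩
    obtain ⟨r, hrI, hr, hk⟩ := hR k q hqI hq
    exact ⟨⟨r, hrI, hr.trans hq⟩, hr, hk⟩
  choose next hext hreq using step
  let c : ℕ → P := fun m => Nat.rec ⟨p, hp, .refl p⟩ (fun i q => next (f i) q) m
  have hmono : ∀ i j, i ≤ j → (c j).1.Extends (c i).1 := by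
    intro i j hij
    induction hij with
    | refl => exact .refl _
    | step _ ih => exact (hext _ _).trans ih
  refine ⟨{x | ∃ i, x ∈ (c i).1.D}, fun k => ?_⟩
  obtain ⟨m, rfl⟩ := hf k
  -- Requirement `f m` is handled in passing to stage m + 1; elements entering later come from the
  -- reservoir of that stage.
  refine ⟨(c (m + 1)).1, (c (m + 1)).2.1, ⟨fun x hx => ⟨m + 1, hx⟩, ?_⟩, hreq _ _⟩
  rintro x ⟨i, hi⟩
  rcases le_total i (m + 1) with h | h
  · exact Or.inl ((hmono _ _ h).1 hi)
  · exact (hmono _ _ h).2.1 x hi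

theorem countable_isSigma (J : Set ℕ) (n : ℕ) : {P | IsSigma J n P}.Countable := by
  induction n with
  | zero =>
    have h : ∀ P : {P | IsSigma J 0 P}, ∃ e, Computes e J P := fun P => exists_computes P.2
    choose f hf using h
    rw [← Set.countable_coe_iff]
    refine Function.Injective.countable (f := f) fun P Q hPQ => Subtype.ext ?_
    exact (hf P).unique (hPQ ▸ hf Q)
  | succ n ih =>
    have h := (ih.image compl).image fun Q => {x | ∃ y, Nat.pair x y ∈ Q}
    refine h.mono ?_
    rintro P ⟨Q, hQ, rfl⟩
    exact ⟨Q, ⟨Qᶜ, hQ, compl_compl Q⟩, rfl⟩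

/-- Every `I`-condition has an index and an index determines its condition, so a collection is
recovered from its index set. -/
theorem countable_isSigmaCollection (hpair : IsExactPair A₀ A₁ I) (n : ℕ) :
    {C | IsSigmaCollection I A₀ A₁ n C}.Countable := by
  have : Countable {P | IsSigma (join A₀ A₁) n P} := (countable_isSigma _ n).to_subtype
  rw [← Set.countable_coe_iff]
  have key : ∀ C C', IsSigmaCollection I A₀ A₁ n C →
      {c | ∃ p ∈ C, IsIndex A₀ A₁ p c} = {c | ∃ p ∈ C', IsIndex A₀ A₁ p c} → C ⊆ C' := by
    intro C C' hC h p hp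
    obtain ⟨c, hc⟩ := exists_isIndex hpair p (hC.1 p hp)
    obtain ⟨q, hq, hcq⟩ := (Set.ext_iff.1 h c).1 ⟨p, hp, hc⟩
    rwa [hc.unique hcq]
  refine Function.Injective.countable
    (f := fun C : {C | IsSigmaCollection I A₀ A₁ n C} =>
      (⟨{c | ∃ p ∈ C.1, IsIndex A₀ A₁ p c}, C.2.2⟩ : {P | IsSigma (join A₀ A₁) n P})) ?_
  intro C C' h
  have h := congrArg Subtype.val h
  exact Subtype.ext ((key _ _ C.2 h).antisymm (key _ _ C'.2 h.symm))

/-! ### Avoiding the computation of a set -/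

/-- The string `σ` is an initial segment of a set between `D` and the union of `D` with the set
of positions at which `τ` is true. -/
def Admissible (D : List ℕ) (τ σ : List Bool) : Prop :=
  ∀ i < σ.length, σ[i]? = some true ∧ (i ∈ D ∨ τ[i]? = some true) ∨
    ¬ σ[i]? = some true ∧ ¬ i ∈ D

/-- The first value at `x` of the `e`-th functional on a string admissible for `D` and `τ`. -/
noncomputable def searchStr (D : List ℕ) (e : ℕ) (τ : List Bool) (x : ℕ) : Option ℕ :=
  open Classical in
  firstSome (fun k => if Admissible D τ (strOfNat k) then phiStr e (strOfNat k) x else none)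
    τ.length

theorem primrec_searchStr (D : List ℕ) (e : ℕ) : Primrec₂ (searchStr D e) := by
  classical
  have hD : PrimrecPred fun x : ℕ => x ∈ D :=
    (PrimrecRel.exists_mem_list (R := fun a b : ℕ => a = b) Primrec.eq).comp
      (Primrec.const D) Primrec.id |>.of_eq (by simp)
  have hget {α : Type} [Primcodable α] {f : α → List Bool} {g : α → ℕ} (hf : Primrec f)
      (hg : Primrec g) : PrimrecPred fun a => (f a)[g a]? = some true :=
    PrimrecRel.comp Primrec.eq (Primrec.list_getElem?.comp hf hg) (Primrec.const _)
  have hrel : PrimrecRel fun (i : ℕ) (q : List Bool × List Bool) =>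
      q.2[i]? = some true ∧ (i ∈ D ∨ q.1[i]? = some true) ∨
        ¬ q.2[i]? = some true ∧ ¬ i ∈ D := by
    have h1 : PrimrecPred fun p : ℕ × (List Bool × List Bool) => p.2.2[p.1]? = some true :=
      hget (Primrec.snd.comp Primrec.snd) Primrec.fst
    have h2 : PrimrecPred fun p : ℕ × (List Bool × List Bool) => p.2.1[p.1]? = some true :=
      hget (Primrec.fst.comp Primrec.snd) Primrec.fst
    have h3 := hD.comp (f := fun p : ℕ × (List Bool × List Bool) => p.1) Primrec.fst
    exact ((h1.and (h3.or h2)).or (h1.not.and h3.not)).primrecRel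
  have hadm : PrimrecPred fun q : List Bool × List Bool => Admissible D q.1 q.2 :=
    ((PrimrecRel.forall_mem_list hrel).comp (Primrec.list_range.comp
      (Primrec.list_length.comp Primrec.snd)) Primrec.id).of_eq fun q => by
        simp only [List.mem_range, Admissible, id]
  have hσ : Primrec fun p : (List Bool × ℕ) × ℕ => strOfNat p.2 :=
    primrec_strOfNat.comp Primrec.snd
  exact primrec_firstSome (Primrec.ite (hadm.comp ((Primrec.fst.comp Primrec.fst).pair hσ))
    (primrec_phiStr (Primrec.const e) hσ (Primrec.snd.comp Primrec.fst)) (Primrec.const none)).to₂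
    (Primrec.list_length.comp Primrec.fst)

/-- If no extension of `p` forces the `e`-th functional not to compute `A`, then the reservoir
of `p` is hereditarily uniformly `A`-computing. -/
theorem hereditarilyUniformlyComputing_of_not_forced (hI : IsTuringIdeal I) (p : MathiasCondition)
    (e : ℕ) (h : ∀ q : MathiasCondition, q.S ∈ I → q.Extends p →
      ∃ G, Satisfies G q ∧ Computes e G A) : HereditarilyUniformlyComputing I A p.S := by
  classical
  obtain ⟨e', he'⟩ := exists_functional (primrec_searchStr p.D.toList e)
  refine ⟨e', fun V hV hVS hinf x => he' V x _ ?_ ?_⟩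
  · intro s v hv
    obtain ⟨k, -, hk⟩ := exists_of_firstSome hv
    split_ifs at hk with hadm
    generalize strOfNat k = σ at hadm hk
    -- The true positions of σ join the finite part and the reservoir starts past σ, so every set
    -- satisfying `q` begins with σ. One of them computes `A`, which makes the value found on σ
    -- correct.
    obtain ⟨q, hqI, hqS, -, hqD⟩ := exists_extension_upto hI
      (p.D ∪ (Finset.range σ.length).filter fun i => σ[i]? = some true)
      (hI.diff_finite_mem hV (Set.finite_lt_nat σ.length))
      (hinf.sdiff (Set.finite_lt_nat σ.length)) 0
    simp only [Finset.mem_union, Finset.mem_filter, Finset.mem_range] at hqD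
    have hqp : ∀ y ∈ q.D, y ∈ p.D ∨ y ∈ p.S := by
      intro y hy
      rcases (hqD y).1 hy with (h1 | ⟨hyσ, h1⟩) | h1
      · exact Or.inl h1
      · rcases hadm y hyσ with h2 | h2
        · exact h2.2.imp Finset.mem_toList.1 fun h3 => hVS (mem_of_getElem?_restrict h3)
        · exact absurd h1 h2.1
      · exact Or.inr (hVS h1.1.1)
    obtain ⟨G, hGq, hG⟩ := h q hqI ⟨fun y hy => (hqD y).2 (Or.inl (Or.inl hy)), hqp,
      (hqS.trans Set.sdiff_subset).trans hVS⟩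
    have hσ : σ = restrict G σ.length := by
      refine eq_restrict fun i hi => ⟨fun h1 => ?_, fun hiG => ?_⟩
      · exact hGq.1 i ((hqD i).2 (Or.inl (Or.inr ⟨hi, h1⟩)))
      · rcases hGq.2 i hiG with hiD | hiS
        · rcases (hqD i).1 hiD with (h1 | h1) | h1
          · rcases hadm i hi with h2 | h2
            · exact h2.1
            · exact absurd (Finset.mem_toList.2 h1) h2.2
          · exact h1.2
          · exact absurd hi h1.1.2
        · exact absurd hi (hqS hiS).2
    rw [hσ] at hk
    exact hG.eq_chi hk
  -- The search succeeds: some set satisfying (D, V) computes `A`, and its segments are admissible.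
  · obtain ⟨G, hGq, hG⟩ := h ⟨p.D, V, hinf, fun d hd y hy => p.lt d hd y (hVS hy)⟩ hV
      ⟨subset_rfl, fun y hy => Or.inl hy, hVS⟩
    obtain ⟨s, hs⟩ := computes_iff.1 hG x
    -- The segment of `V` must cover the positions of the string and also be longer than its code,
    -- since its length bounds the search.
    have hk : encode (restrict G s) < max s (encode (restrict G s) + 1) := by omega
    refine ⟨max s (encode (restrict G s) + 1), Option.isSome_iff_exists.2 (firstSome_isSome
      (m := encode (restrict G s)) (by rwa [length_restrict]) ?_)⟩
    have hadm : Admissible p.D.toList (restrict V (max s (encode (restrict G s) + 1)))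
        (restrict G s) := by
      intro i hi
      rw [length_restrict] at hi
      rw [getElem?_restrict G hi, getElem?_restrict V (lt_max_of_lt_left hi), Finset.mem_toList]
      by_cases hiG : i ∈ G
      · exact Or.inl (by simpa [hiG] using hGq.2 i hiG)
      · exact Or.inr ⟨by simp [hiG], fun hD => hiG (hGq.1 i hD)⟩
    rw [strOfNat_encode, if_pos hadm, hs]
    rfl

/-- The requirements are to decide each definable collection and to defeat each functional. One of
the latter that could not be forced below q would make `q.S`, a subset of `S`, hereditarily
uniformly `A`-computing. -/
theorem exists_isGeneric_not_reducible (hI : IsTuringIdeal I) (hpair : IsExactPair A₀ A₁ I) (n : ℕ)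
    {S : Set ℕ} (hS : S ∈ I) (hinf : S.Infinite)
    (h : ∀ T ∈ I, T ⊆ S → T.Infinite → ¬ HereditarilyUniformlyComputing I A T) :
    ∃ G, IsGeneric I A₀ A₁ n G ∧ ¬ SetTuringReducible A G := by
  have : Countable {C | IsSigmaCollection I A₀ A₁ n C} :=
    (countable_isSigmaCollection hpair n).to_subtype
  let R : {C | IsSigmaCollection I A₀ A₁ n C} ⊕ ℕ → MathiasCondition → Prop := fun k q =>
    Sum.elim (fun C => q ∈ C.1 ∨ ∀ r ∈ C.1, ¬ r.Extends q)
      (fun e => ∀ G, Satisfies G q → ¬ Computes e G A) k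
  suffices hR : ∀ k q, q.S ∈ I → q.Extends ⟨∅, S, hinf, by simp⟩ →
      ∃ r : MathiasCondition, r.S ∈ I ∧ r.Extends q ∧ R k r by
    obtain ⟨G, hG⟩ := exists_forall_satisfies _ hS R hR
    refine ⟨G, fun C hC => ?_, fun hA => ?_⟩
    · obtain ⟨q, hqI, hGq, hq | hq⟩ := hG (Sum.inl ⟨C, hC⟩)
      · exact Or.inl ⟨q, hq, hGq⟩
      · exact Or.inr ⟨q, hqI, hGq, hq⟩
    · obtain ⟨e, he⟩ := exists_computes hA
      obtain ⟨q, -, hGq, hq⟩ := hG (Sum.inr e)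
      exact hq G hGq he
  rintro (⟨C, hC⟩ | e) q hqI hq
  · by_cases hex : ∃ r ∈ C, r.Extends q
    · obtain ⟨r, hr, hrq⟩ := hex
      exact ⟨r, hC.1 r hr, hrq, Or.inl hr⟩
    · exact ⟨q, hqI, .refl q, Or.inr fun r hr hrq => hex ⟨r, hr, hrq⟩⟩
  · by_contra hno
    refine h q.S hqI hq.2.2 q.infinite
      (hereditarilyUniformlyComputing_of_not_forced hI q e fun r hrI hrq => ?_)
    by_contra hr
    exact hno ⟨r, hrI, hrq, fun G hGr hGA => hr ⟨G, hGr, hGA⟩⟩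

end

end MathiasForcing

theorem mainTheorem5 (I : Set (Set ℕ)) (hI : MathiasForcing.IsTuringIdeal I)
    (A₀ A₁ : Set ℕ) (hpair : MathiasForcing.IsExactPair A₀ A₁ I)
    (n : ℕ) (hn : 4 ≤ n) (A : Set ℕ) (hA : MathiasForcing.IsDelta ∅ n A) :
    (∀ G : Set ℕ, MathiasForcing.IsGeneric I A₀ A₁ n G →
        MathiasForcing.SetTuringReducible A G) ↔
      ∀ S ∈ I, S.Infinite →
        ∃ T ∈ I, T ⊆ S ∧ T.Infinite ∧
          MathiasForcing.HereditarilyUniformlyComputing I A T := by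
  refine ⟨fun h S hS hinf => ?_, fun h G hG => hG.reducible hI hpair hn h⟩
  by_contra hno
  obtain ⟨G, hG, hGA⟩ := MathiasForcing.exists_isGeneric_not_reducible hI hpair n hS hinf
    fun T hT hTS hTinf hTA => hno ⟨T, hT, hTS, hTinf, hTA⟩
  exact hGA (h G hG)
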